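/- **Theorem 2.6.** Let $m\ge 2$ and $k\ge 2$ be integers, and consider the hierarchical normal model in which, independently for $i=1,\dots,m$, $$\mathbf X_i\mid\boldsymbol\theta_i\sim N_k(\boldsymbol\theta_i,\mathbf I),\qquad \boldsymbol\theta_i\mid\boldsymbol\beta,\mathbf V\sim N_k(\boldsymbol\beta,\mathbf V),$$ with $\boldsymbol\beta\in\mathbb R^k$ and $\mathbf V$ a positive definite symmetric $k\times k$ matrix. Let the (possibly improper) hyperprior have density $\pi(\boldsymbol\beta,\mathbf V)=\pi(\boldsymbol\beta)\,\pi(\mathbf V)$ with respect to $d\boldsymbol\beta\,d\mathbf V$, where $d\mathbf V=\prod_{i\le j}dV_{ij}$ and $\pi(\boldsymbol\beta)=1$, and where the measurable function $\pi(\mathbf V)\ge 0$ satisfies the following condition for some real numbers $a_1,a_2$ and some $0\le l\le 1$: there are constants $C_1,C_2>0$ such that for all positive definite $\mathbf V$ with distinct eigenvalues $d_1>d_2>\dots>d_k>0$, $$\frac{C_1}{|\mathbf I+\mathbf V|^{a_2-a_1}\,|\mathbf V|^{a_1}\bigl[\prod_{i<j}(d_i-d_j)\bigr]^{1-l}}\le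 \pi(\mathbf V)\le\frac{C_2}{|\mathbf I+\mathbf V|^{a_2-a_1}\,|\mathbf V|^{a_1}\bigl[\prod_{i<j}(d_i-d_j)\bigr]^{1-l}},$$ where $|\cdot|$ denotes the determinant. For $\mathbf x=(\mathbf x_1,\dots,\mathbf x_m)\in(\mathbb R^k)^m$ let $$m(\mathbf x)=\int\!\!\int\!\!\int f(\mathbf x\mid\boldsymbol\theta)\,\pi(\boldsymbol\theta\mid\boldsymbol\beta,\mathbf V)\,\pi(\boldsymbol\beta)\,\pi(\mathbf V)\,d\mathbf V\,d\boldsymbol\beta\,d\boldsymbol\theta\in[0,\infty],$$ where $f(\mathbf x\mid\boldsymbol\theta)$ and $\pi(\boldsymbol\theta\mid\boldsymbol\beta,\mathbf V)$ are the normal densities of the model. Then, for every $\mathbf x$, the posterior distribution of $(\boldsymbol\theta,\boldsymbol\beta,\mathbf V)$ given $\mathbf x$ exists (is proper), that is, $0<m(\mathbf x)<\infty$ and the joint density divided by $m(\mathbf x)$ is a probability density, if and only if $$a_1<1\quad\text{and}\quad a_2>\frac{3-m}{2}+(k-1)\,l .$$ -/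

import Mathlib

open MeasureTheory
open scoped NNReal ENNReal Matrix

noncomputable section

namespace HierNormal

/-- The product (Borel) σ-algebra on the space of matrices. -/
instance instMeasurableSpaceMatrix (k : ℕ) : MeasurableSpace (Matrix (Fin k) (Fin k) ℝ) :=
  inferInstanceAs (MeasurableSpace (Fin k → Fin k → ℝ))

/-- Index set of the free coordinates `V i j`, `i ≤ j`, of a symmetric `k × k` matrix. -/
abbrev UpperIdx (k : ℕ) : Type := {p : Fin k × Fin k // p.1 ≤ p.2}

/-- The symmetric matrix with prescribed entries on and above the diagonal. -/
def symOfUpper (k : ℕ) (v : UpperIdx k → ℝ) : Matrix (Fin k) (Fin k) ℝ :=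
  Matrix.of fun i j => v ⟨(min i j, max i j), min_le_max⟩

theorem measurable_symOfUpper (k : ℕ) : Measurable (symOfUpper k) :=
  measurable_pi_lambda _ fun _ => measurable_pi_lambda _ fun _ => measurable_pi_apply _

/-- The measure `dV = ∏_{i ≤ j} dV_ij`: Lebesgue measure on the symmetric matrices,
in the coordinates on and above the diagonal. -/
def symVolume (k : ℕ) : Measure (Matrix (Fin k) (Fin k) ℝ) :=
  Measure.map (symOfUpper k) volume

/-- `dV` restricted to the set of positive definite matrices, the domain of the
hyper-covariance matrix `V`. -/
def covVolume (k : ℕ) : Measure (Matrix (Fin k) (Fin k) ℝ) :=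
  (symVolume k).restrict {V | V.PosDef}

/-- The two-sided bound on the prior density `π(V)`. It is imposed at each positive definite `V`
with distinct eigenvalues `d 0 > d 1 > ⋯ > d (k-1)`. -/
def Condition1 (k : ℕ) (l a₁ a₂ : ℝ) (π : Matrix (Fin k) (Fin k) ℝ → ℝ≥0) : Prop :=
  ∃ C₁ C₂ : ℝ, 0 < C₁ ∧ 0 < C₂ ∧
    ∀ V : Matrix (Fin k) (Fin k) ℝ, V.PosDef →
      ∀ d : Fin k → ℝ, StrictAnti d → Set.range d = spectrum ℝ V →
        C₁ / ((1 + V).det ^ (a₂ - a₁) * V.det ^ a₁ *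
            (∏ i, ∏ j ∈ Finset.Ioi i, (d i - d j)) ^ (1 - l)) ≤ (π V : ℝ) ∧
        (π V : ℝ) ≤ C₂ / ((1 + V).det ^ (a₂ - a₁) * V.det ^ a₁ *
            (∏ i, ∏ j ∈ Finset.Ioi i, (d i - d j)) ^ (1 - l))

/-- Sampling density `f(x | θ)`: independently, `x i ∼ N_k(θ i, I)` for `i = 1, …, m`. -/
def samplingDensity {m k : ℕ} (x θ : Fin m → Fin k → ℝ) : ℝ :=
  1 / (2 * Real.pi) ^ ((m * k : ℝ) / 2) *
    Real.exp (-(1 / 2) * ∑ i, (x i - θ i) ⬝ᵥ (x i - θ i))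

/-- First stage prior density `π(θ | β, V)`: independently, `θ i ∼ N_k(β, V)`. -/
def stageDensity {m k : ℕ} (θ : Fin m → Fin k → ℝ) (β : Fin k → ℝ)
    (V : Matrix (Fin k) (Fin k) ℝ) : ℝ :=
  1 / ((2 * Real.pi) ^ ((m * k : ℝ) / 2) * V.det ^ ((m : ℝ) / 2)) *
    Real.exp (-(1 / 2) * ∑ i, (θ i - β) ⬝ᵥ (V⁻¹ *ᵥ (θ i - β)))

/-- The hyperprior density of Case 1: `π(β) = 1`. -/
def constPrior {k : ℕ} (_β : Fin k → ℝ) : ℝ≥0 := 1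

/-- The joint density `f(x | θ) π(θ | β, V) π(β) π(V)`. -/
def jointDensity {m k : ℕ} (πβ : (Fin k → ℝ) → ℝ≥0) (πV : Matrix (Fin k) (Fin k) ℝ → ℝ≥0)
    (x θ : Fin m → Fin k → ℝ) (β : Fin k → ℝ) (V : Matrix (Fin k) (Fin k) ℝ) : ℝ≥0∞ :=
  ENNReal.ofReal (samplingDensity x θ) * ENNReal.ofReal (stageDensity θ β V) * πβ β * πV V

/-- The marginal density `m(x) = ∫∫∫ f(x | θ) π(θ | β, V) π(β) π(V) dV dβ dθ`,
with values in `[0, ∞]`. -/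
def marginal {m k : ℕ} (πβ : (Fin k → ℝ) → ℝ≥0) (πV : Matrix (Fin k) (Fin k) ℝ → ℝ≥0)
    (x : Fin m → Fin k → ℝ) : ℝ≥0∞ :=
  ∫⁻ θ : Fin m → Fin k → ℝ, ∫⁻ β : Fin k → ℝ,
    ∫⁻ V : Matrix (Fin k) (Fin k) ℝ, jointDensity πβ πV x θ β V ∂(covVolume k)

/-- The formal posterior of `(θ, β, V)` given `x`: the measure whose density with respect to
`dθ dβ dV` is the joint density divided by `m(x)`. -/
def posterior {m k : ℕ} (πβ : (Fin k → ℝ) → ℝ≥0) (πV : Matrix (Fin k) (Fin k) ℝ → ℝ≥0)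
    (x : Fin m → Fin k → ℝ) :
    Measure ((Fin m → Fin k → ℝ) × (Fin k → ℝ) × Matrix (Fin k) (Fin k) ℝ) :=
  (marginal πβ πV x)⁻¹ •
    ((volume : Measure (Fin m → Fin k → ℝ)).prod
      ((volume : Measure (Fin k → ℝ)).prod (covVolume k))).withDensity
        fun p => jointDensity πβ πV x p.1 p.2.1 p.2.2

/-- The posterior distribution given `x` exists (is proper): the marginal density satisfies
`0 < m(x) < ∞`, and normalizing by it gives a probability distribution. -/
def PosteriorExists {m k : ℕ} (πβ : (Fin k → ℝ) → ℝ≥0)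
    (πV : Matrix (Fin k) (Fin k) ℝ → ℝ≥0) (x : Fin m → Fin k → ℝ) : Prop :=
  0 < marginal πβ πV x ∧ marginal πβ πV x < ∞ ∧ IsProbabilityMeasure (posterior πβ πV x)

end HierNormal

end

open MeasureTheory
open scoped NNReal ENNReal Matrix

noncomputable section

namespace HierNormal

/-! ### One-dimensional integrals: Gaussian kernels and powers. -/

section RealIntegrals

/-! By Tonelli, `m(x)` is the integral over `V` of `π(V)` times the density of the data given `V`.
Write `V = Q D Qᵀ` and rotate all vectors by `Qᵀ`: the Gaussian integrals over `θ` and `β` split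
into coordinates. In coordinate `j`, integrating out `θ` turns the variance `d j` into `1 + d j`.
The flat prior on `β` then recovers one factor `√(1 + d j)` of the `m` lost. For fixed `x` the
density given `V` therefore lies between two positive multiples of `∏ (1 + d j) ^ (-(m - 1) / 2)`,
uniformly in `Q` and `D` (`exists_covMarginal_bounds`).

In spectral coordinates `dV` is the product of the gaps `d i - d j` times `dd` times an angular
measure on a compact group. Only two-sided bounds are needed, so Haar measure is avoided. The Cayley
transform parametrizes the orthogonal matrices near `1` by skew-symmetric ones, the Jacobian factors
exactly into the gaps and an angular term bounded above and below, and finitely many translates of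
this chart cover the orthogonal group (`exists_polar_bounds`).

The Jacobian's gap product meets the power `-(1 - l)` in the prior and leaves the power `l`. So
`m(x)` is comparable to the integral over decreasing positive `d` of `∏ (1 + d i) ^ (-e) * d i ^
(-a₁)` times the gap product to the power `l`, where `e = a₂ - a₁ + (m - 1) / 2`
(`exists_marginal_bounds`).

This integral converges iff `a₁ < 1` and `a₁ + e - (k - 1) * l > 1`. For sufficiency, the gap
product is at most `∏ (1 + d i) ^ (k - 1)`, which makes the integrand a product of one-variable
functions. The crude bound loses nothing: when the largest eigenvalue alone goes to infinity,
exactly `k - 1` gaps grow with it. For necessity, send only the smallest eigenvalue to `0`, or only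
the largest to infinity, with the others in fixed separated intervals. The second inequality is the
stated bound on `a₂`. -/

theorem lintegral_fin_prod_eq_prod {E : Type*} [MeasureSpace E] [SigmaFinite (volume : Measure E)] :
    ∀ {n : ℕ} (f : Fin n → E → ℝ≥0∞), (∀ i, Measurable (f i)) →
      ∫⁻ x : Fin n → E, ∏ i, f i (x i) = ∏ i, ∫⁻ x, f i x
  | 0, f, _ => by
      simp [volume_pi]
  | n + 1, f, hf => by
      have hm : Measurable fun y : E × (Fin n → E) => f 0 y.1 * ∏ i : Fin n, f i.succ (y.2 i) :=
        ((hf 0).comp measurable_fst).mul (Finset.measurable_prod _ fun i _ =>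
          (hf i.succ).comp ((measurable_pi_apply i).comp measurable_snd))
      have h := (volume_preserving_piFinSuccAbove (fun _ : Fin (n + 1) => E) 0).lintegral_comp hm
      rw [Fin.prod_univ_succ, ← lintegral_fin_prod_eq_prod (fun i => f i.succ) fun i => hf _,
        ← lintegral_prod_mul (hf 0).aemeasurable (Finset.measurable_prod _ fun i _ =>
          (hf i.succ).comp (measurable_pi_apply i)).aemeasurable]
      refine Eq.trans ?_ h
      refine lintegral_congr fun x => ?_
      rw [Fin.prod_univ_succ]
      rfl

/-- Tonelli's theorem for a product of functions of the separate coordinates. -/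
theorem lintegral_fintype_prod_eq_prod {ι E : Type*} [Fintype ι] [MeasureSpace E]
    [SigmaFinite (volume : Measure E)] (f : ι → E → ℝ≥0∞) (hf : ∀ i, Measurable (f i)) :
    ∫⁻ x : ι → E, ∏ i, f i (x i) = ∏ i, ∫⁻ x, f i x := by
  let e := (Fintype.equivFin ι).symm
  have hm : Measurable fun x : ι → E => ∏ i, f i (x i) :=
    Finset.measurable_prod _ fun i _ => (hf i).comp (measurable_pi_apply i)
  rw [← (volume_measurePreserving_piCongrLeft (fun _ : ι => E) e).lintegral_comp hm]
  simp_rw [← e.prod_comp, MeasurableEquiv.coe_piCongrLeft, Equiv.piCongrLeft_apply_apply]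
  exact lintegral_fin_prod_eq_prod (fun i => f (e i)) fun i => hf _

theorem lintegral_exp_neg_mul_sq_sub {p : ℝ} (hp : 0 < p) (q : ℝ) :
    ∫⁻ t : ℝ, ENNReal.ofReal (Real.exp (-p * (t - q) ^ 2)) = ENNReal.ofReal √(Real.pi / p) := by
  rw [lintegral_sub_right_eq_self (fun t : ℝ => ENNReal.ofReal (Real.exp (-p * t ^ 2))) q,
    ← ofReal_integral_eq_lintegral_ofReal (integrable_exp_neg_mul_sq hp)
      (ae_of_all _ fun _ => (Real.exp_pos _).le), integral_gaussian]

/-- The convolution of the kernels of `N(0, 1)` and `N(0, d)`. -/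
theorem lintegral_exp_convolution {d : ℝ} (hd : 0 < d) (y b : ℝ) :
    ∫⁻ t : ℝ, ENNReal.ofReal (Real.exp (-(1 / 2) * ((y - t) ^ 2 + (t - b) ^ 2 / d))) =
      ENNReal.ofReal (√(2 * Real.pi * d / (1 + d)) *
        Real.exp (-(1 / 2) * ((y - b) ^ 2 / (1 + d)))) := by
  have h1 : (0 : ℝ) < 1 + d := by positivity
  -- Complete the square in `t`: the product of the two kernels is centred at the precision-weighted
  -- mean of `y` and `b`.
  have key : ∀ t : ℝ, ENNReal.ofReal (Real.exp (-(1 / 2) * ((y - t) ^ 2 + (t - b) ^ 2 / d))) =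
      ENNReal.ofReal (Real.exp (-(1 / 2) * ((y - b) ^ 2 / (1 + d)))) *
      ENNReal.ofReal (Real.exp (-((1 + d) / (2 * d)) * (t - (d * y + b) / (1 + d)) ^ 2)) := by
    intro t
    rw [← ENNReal.ofReal_mul (Real.exp_pos _).le, ← Real.exp_add]
    congr 2
    field_simp
    ring
  simp_rw [key]
  rw [lintegral_const_mul _ (by fun_prop), lintegral_exp_neg_mul_sq_sub (by positivity),
    ← ENNReal.ofReal_mul (Real.exp_pos _).le, mul_comm]
  congr 3
  field_simp

/-- Splitting off the mean `c` of `y` gives the exact value, with `∑ (y i) ^ 2 - m * c ^ 2` left in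
the exponent. That quantity lies between `0` and `∑ (y i) ^ 2`, whence the two bounds. -/
theorem lintegral_exp_sum_sq_le {m : ℕ} (hm : 0 < m) {s : ℝ} (hs : 0 < s) (y : Fin m → ℝ) :
    ∫⁻ b : ℝ, ENNReal.ofReal (Real.exp (-(1 / 2) * ((∑ i, (y i - b) ^ 2) / s))) ≤
      ENNReal.ofReal √(2 * Real.pi * s / m) ∧
    ENNReal.ofReal (√(2 * Real.pi * s / m) * Real.exp (-(1 / 2) * ((∑ i, y i ^ 2) / s))) ≤
      ∫⁻ b : ℝ, ENNReal.ofReal (Real.exp (-(1 / 2) * ((∑ i, (y i - b) ^ 2) / s))) := by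
  have hm' : (0 : ℝ) < m := by exact_mod_cast hm
  set c : ℝ := (∑ i, y i) / m with hc
  have hsum : ∀ b : ℝ, ∑ i, (y i - b) ^ 2 = m * (b - c) ^ 2 + (∑ i, y i ^ 2 - m * c ^ 2) := by
    intro b
    have hcy : ∑ i, y i = m * c := by rw [hc]; field_simp
    simp only [sub_sq, Finset.sum_add_distrib, Finset.sum_sub_distrib, ← Finset.sum_mul,
      ← Finset.mul_sum, hcy, Finset.sum_const, Finset.card_univ, Fintype.card_fin, nsmul_eq_mul]
    ring
  have hnn : 0 ≤ ∑ i, y i ^ 2 - m * c ^ 2 := by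
    have := hsum c
    rw [sub_self] at this
    have h2 : 0 ≤ ∑ i, (y i - c) ^ 2 := Finset.sum_nonneg fun _ _ => sq_nonneg _
    linarith
  have key : ∫⁻ b : ℝ, ENNReal.ofReal (Real.exp (-(1 / 2) * ((∑ i, (y i - b) ^ 2) / s))) =
      ENNReal.ofReal (√(2 * Real.pi * s / m) *
        Real.exp (-(1 / 2) * ((∑ i, y i ^ 2 - m * c ^ 2) / s))) := by
    have : ∀ b : ℝ, ENNReal.ofReal (Real.exp (-(1 / 2) * ((∑ i, (y i - b) ^ 2) / s))) =
        ENNReal.ofReal (Real.exp (-(1 / 2) * ((∑ i, y i ^ 2 - m * c ^ 2) / s))) *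
        ENNReal.ofReal (Real.exp (-(m / (2 * s)) * (b - c) ^ 2)) := by
      intro b
      rw [← ENNReal.ofReal_mul (Real.exp_pos _).le, ← Real.exp_add, hsum]
      congr 2
      field_simp
      ring
    simp_rw [this]
    rw [lintegral_const_mul _ (by fun_prop), lintegral_exp_neg_mul_sq_sub (by positivity),
      ← ENNReal.ofReal_mul (Real.exp_pos _).le, mul_comm]
    congr 3
    field_simp
  rw [key]
  constructor
  · refine ENNReal.ofReal_le_ofReal (mul_le_of_le_one_right (Real.sqrt_nonneg _) ?_)
    rw [Real.exp_le_one_iff]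
    have : 0 ≤ (∑ i, y i ^ 2 - m * c ^ 2) / s := by positivity
    linarith
  · refine ENNReal.ofReal_le_ofReal (mul_le_mul_of_nonneg_left ?_ (Real.sqrt_nonneg _))
    refine Real.exp_le_exp.2 ?_
    have : (∑ i, y i ^ 2 - m * c ^ 2) / s ≤ (∑ i, y i ^ 2) / s := by
      gcongr
      have := mul_nonneg hm'.le (sq_nonneg c)
      linarith
    linarith

theorem lintegral_Ioo_rpow_eq_top {a : ℝ} (ha : a ≤ -1) :
    ∫⁻ t in Set.Ioo (0 : ℝ) 1, ENNReal.ofReal (t ^ a) = ∞ := by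
  by_contra h
  have : IntegrableOn (fun t : ℝ => t ^ a) (Set.Ioo 0 1) := by
    refine ⟨by fun_prop, ?_⟩
    rw [hasFiniteIntegral_iff_ofReal]
    · exact lt_top_iff_ne_top.2 h
    · exact (ae_restrict_mem measurableSet_Ioo).mono fun t ht => Real.rpow_nonneg ht.1.le _
  rw [intervalIntegral.integrableOn_Ioo_rpow_iff one_pos] at this
  linarith

theorem lintegral_Ioi_rpow_eq_top {a R : ℝ} (ha : -1 ≤ a) (hR : 0 < R) :
    ∫⁻ t in Set.Ioi R, ENNReal.ofReal (t ^ a) = ∞ := by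
  by_contra h
  have : IntegrableOn (fun t : ℝ => t ^ a) (Set.Ioi R) := by
    refine ⟨by fun_prop, ?_⟩
    rw [hasFiniteIntegral_iff_ofReal]
    · exact lt_top_iff_ne_top.2 h
    · exact (ae_restrict_mem measurableSet_Ioi).mono fun t ht =>
        Real.rpow_nonneg (hR.trans ht).le _
  rw [integrableOn_Ioi_rpow_iff hR] at this
  linarith

theorem one_add_rpow_le {x t : ℝ} (hx : 0 ≤ x) (hx1 : x ≤ 1) : (1 + x) ^ t ≤ 2 ^ |t| := by
  calc (1 + x) ^ t ≤ (1 + x) ^ |t| :=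
        Real.rpow_le_rpow_of_exponent_le (by linarith) (le_abs_self t)
    _ ≤ 2 ^ |t| := Real.rpow_le_rpow (by linarith) (by linarith) (abs_nonneg t)

/-- The integrand behaves like `t ^ (-a)` near `0` and like `t ^ (-(a + e))` at infinity; the
half-line is cut at `1`. -/
theorem lintegral_Ioi_rpow_mul_one_add_rpow_lt_top {a e : ℝ} (ha : a < 1) (hae : 1 < a + e) :
    ∫⁻ t in Set.Ioi (0 : ℝ), ENNReal.ofReal ((1 + t) ^ (-e) * t ^ (-a)) < ∞ := by
  rw [← Set.Ioc_union_Ioi_eq_Ioi (zero_le_one' ℝ)]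
  refine (lintegral_union_le _ _ _).trans_lt (ENNReal.add_lt_top.2 ⟨?_, ?_⟩)
  · have h : IntegrableOn (fun t : ℝ => 2 ^ |(-e)| * t ^ (-a)) (Set.Ioc 0 1) :=
      ((integrableOn_Ioc_iff_integrableOn_Ioo).2
        ((intervalIntegral.integrableOn_Ioo_rpow_iff one_pos).2 (by linarith))).const_mul _
    refine lt_of_le_of_lt ?_ h.lintegral_lt_top
    refine setLIntegral_mono' measurableSet_Ioc fun t ht => ENNReal.ofReal_le_ofReal ?_
    exact mul_le_mul_of_nonneg_right (one_add_rpow_le ht.1.le ht.2) (Real.rpow_nonneg ht.1.le _)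
  · have h : IntegrableOn (fun t : ℝ => 2 ^ |(-e)| * t ^ (-(a + e))) (Set.Ioi 1) :=
      ((integrableOn_Ioi_rpow_iff one_pos).2 (by linarith)).const_mul _
    refine lt_of_le_of_lt ?_ h.lintegral_lt_top
    refine setLIntegral_mono' measurableSet_Ioi fun t ht => ENNReal.ofReal_le_ofReal ?_
    have ht0 : (0 : ℝ) < t := one_pos.trans ht
    have h1 : (1 + t) = (1 + t⁻¹) * t := by field_simp; ring
    rw [h1, Real.mul_rpow (by positivity) ht0.le, neg_add, Real.rpow_add ht0, mul_assoc,
      mul_comm (t ^ (-a))]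
    refine mul_le_mul_of_nonneg_right (one_add_rpow_le (by positivity) ?_) (by positivity)
    exact inv_le_one_of_one_le₀ (le_of_lt ht)

end RealIntegrals

variable {k : ℕ}

/-! ### Symmetric and skew-symmetric matrices in upper-triangular coordinates. -/

section Coordinates

/-- The entries of a matrix on and above the diagonal. -/
def upperEntries (k : ℕ) : Matrix (Fin k) (Fin k) ℝ →ₗ[ℝ] (UpperIdx k → ℝ) where
  toFun M p := M p.1.1 p.1.2
  map_add' _ _ := rfl
  map_smul' _ _ := rfl

/-- `symOfUpper` as a linear map. -/
def symLin (k : ℕ) : (UpperIdx k → ℝ) →ₗ[ℝ] Matrix (Fin k) (Fin k) ℝ where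
  toFun := symOfUpper k
  map_add' _ _ := rfl
  map_smul' _ _ := rfl

/-- The skew-symmetric matrix with prescribed entries above the diagonal. -/
def skewOfUpper (k : ℕ) : (UpperIdx k → ℝ) →ₗ[ℝ] Matrix (Fin k) (Fin k) ℝ where
  toFun v := Matrix.of fun i j =>
    if i < j then symOfUpper k v i j else if j < i then -symOfUpper k v i j else 0
  map_add' v w := by
    ext i j
    simp only [Matrix.of_apply, Matrix.add_apply]
    split_ifs <;> simp [symOfUpper, add_comm]
  map_smul' c v := by
    ext i j
    simp only [Matrix.of_apply, Matrix.smul_apply]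
    split_ifs <;> simp [symOfUpper]

/-- The coordinates on the diagonal. -/
def diagCoords (k : ℕ) : (UpperIdx k → ℝ) →ₗ[ℝ] (Fin k → ℝ) where
  toFun v i := v ⟨(i, i), le_rfl⟩
  map_add' _ _ := rfl
  map_smul' _ _ := rfl

theorem symOfUpper_transpose (v : UpperIdx k → ℝ) : (symOfUpper k v)ᵀ = symOfUpper k v := by
  ext i j
  simp [symOfUpper, min_comm, max_comm]

theorem symOfUpper_apply_of_le (v : UpperIdx k → ℝ) {i j : Fin k} (h : i ≤ j) :
    symOfUpper k v i j = v ⟨(i, j), h⟩ := by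
  simp [symOfUpper, h]

theorem upperEntries_symOfUpper (v : UpperIdx k → ℝ) : upperEntries k (symOfUpper k v) = v := by
  ext p
  exact symOfUpper_apply_of_le v p.2

theorem ext_of_le_of_transpose {M N : Matrix (Fin k) (Fin k) ℝ} (hM : Mᵀ = M) (hN : Nᵀ = N)
    (h : ∀ i j, i ≤ j → M i j = N i j) : M = N := by
  ext i j
  rcases le_total i j with hij | hij
  · exact h i j hij
  · rw [← hM, ← hN]
    exact h j i hij

theorem symOfUpper_upperEntries {M : Matrix (Fin k) (Fin k) ℝ} (hM : Mᵀ = M) :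
    symOfUpper k (upperEntries k M) = M :=
  ext_of_le_of_transpose (symOfUpper_transpose _) hM fun _ _ hij => symOfUpper_apply_of_le _ hij

theorem skewOfUpper_transpose (v : UpperIdx k → ℝ) : (skewOfUpper k v)ᵀ = -skewOfUpper k v := by
  ext i j
  have : symOfUpper k v j i = symOfUpper k v i j := by
    conv_rhs => rw [← symOfUpper_transpose]
    rfl
  rcases lt_trichotomy i j with h | h | h
  · simp [skewOfUpper, h, h.not_gt, this]
  · simp [skewOfUpper, h]
  · simp [skewOfUpper, h, h.not_gt, this]

theorem skewOfUpper_apply_of_lt (v : UpperIdx k → ℝ) {i j : Fin k} (h : i < j) :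
    skewOfUpper k v i j = v ⟨(i, j), h.le⟩ := by
  simp [skewOfUpper, h, symOfUpper_apply_of_le v h.le]

theorem skew_apply_self {S : Matrix (Fin k) (Fin k) ℝ} (hS : Sᵀ = -S) (i : Fin k) : S i i = 0 := by
  have := congrFun (congrFun hS i) i
  simp only [Matrix.transpose_apply, Matrix.neg_apply] at this
  linarith

theorem skewOfUpper_eq_of_forall_lt {S : Matrix (Fin k) (Fin k) ℝ} (hS : Sᵀ = -S)
    {v : UpperIdx k → ℝ} (h : ∀ i j (hij : i < j), v ⟨(i, j), hij.le⟩ = S i j) :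
    skewOfUpper k v = S := by
  ext i j
  rcases lt_trichotomy i j with hij | rfl | hij
  · rw [skewOfUpper_apply_of_lt v hij, h i j hij]
  · rw [skew_apply_self hS, skew_apply_self (skewOfUpper_transpose v)]
  · have h1 := congrFun (congrFun hS i) j
    have h2 := congrFun (congrFun (skewOfUpper_transpose v) i) j
    simp only [Matrix.transpose_apply, Matrix.neg_apply] at h1 h2
    rw [skewOfUpper_apply_of_lt v hij, h j i hij] at h2
    linarith

end Coordinates

/-! ### The Cayley transform between skew-symmetric and orthogonal matrices. -/

section Cayley

/-- The Cayley transform `(1 - S) (1 + S)⁻¹`. -/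
def cayley (S : Matrix (Fin k) (Fin k) ℝ) : Matrix (Fin k) (Fin k) ℝ := (2 : ℝ) • (1 + S)⁻¹ - 1

/-- A skew form vanishes on the diagonal, so `(1 + S) x = 0` forces `x ⬝ᵥ x = 0`. -/
theorem isUnit_det_one_add_of_skew {S : Matrix (Fin k) (Fin k) ℝ} (hS : Sᵀ = -S) :
    IsUnit (1 + S).det := by
  rw [← Matrix.isUnit_iff_isUnit_det, ← Matrix.mulVec_injective_iff_isUnit]
  refine (injective_iff_map_eq_zero (Matrix.mulVecLin (1 + S))).2 fun x hx => ?_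
  have h1 : x ⬝ᵥ (S *ᵥ x) = 0 := by
    have h : x ⬝ᵥ (S *ᵥ x) = x ⬝ᵥ (Sᵀ *ᵥ x) := by
      rw [Matrix.mulVec_transpose, Matrix.dotProduct_mulVec, dotProduct_comm]
    rw [hS, Matrix.neg_mulVec, dotProduct_neg] at h
    linarith
  have h2 : x ⬝ᵥ ((1 + S) *ᵥ x) = 0 := by
    rw [show (1 + S) *ᵥ x = 0 from hx, dotProduct_zero]
  rw [Matrix.add_mulVec, Matrix.one_mulVec, dotProduct_add, h1, add_zero] at h2
  exact dotProduct_self_eq_zero.1 h2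

/-- With `A = (1 + S)⁻¹`, this identity is precisely the orthogonality of `2A - 1`. -/
theorem inv_one_add_add_transpose {S : Matrix (Fin k) (Fin k) ℝ} (hS : Sᵀ = -S) :
    (1 + S)⁻¹ + ((1 + S)⁻¹)ᵀ = (2 : ℝ) • ((1 + S)⁻¹ * ((1 + S)⁻¹)ᵀ) := by
  have hu := isUnit_det_one_add_of_skew hS
  have hA : (1 + S)⁻¹ * (1 + S) = 1 := Matrix.nonsing_inv_mul _ hu
  have hB : (1 - S) * ((1 + S)⁻¹)ᵀ = 1 := by
    have := congrArg Matrix.transpose hA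
    rwa [Matrix.transpose_mul, Matrix.transpose_add, hS, Matrix.transpose_one,
      ← sub_eq_add_neg] at this
  calc (1 + S)⁻¹ + ((1 + S)⁻¹)ᵀ
      = (1 + S)⁻¹ * ((1 - S) * ((1 + S)⁻¹)ᵀ) + (1 + S)⁻¹ * (1 + S) * ((1 + S)⁻¹)ᵀ := by
        rw [hA, hB, mul_one, one_mul]
    _ = (2 : ℝ) • ((1 + S)⁻¹ * ((1 + S)⁻¹)ᵀ) := by
        rw [two_smul]
        noncomm_ring

theorem cayley_mul_transpose {S : Matrix (Fin k) (Fin k) ℝ} (hS : Sᵀ = -S) :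
    cayley S * (cayley S)ᵀ = 1 := by
  have h := inv_one_add_add_transpose hS
  rw [cayley, Matrix.transpose_sub, Matrix.transpose_smul, Matrix.transpose_one, mul_sub, sub_mul,
    smul_mul_smul_comm, mul_one, one_mul, mul_smul, ← h]
  module

theorem cayley_transpose_mul {S : Matrix (Fin k) (Fin k) ℝ} (hS : Sᵀ = -S) :
    (cayley S)ᵀ * cayley S = 1 :=
  mul_eq_one_comm.1 (cayley_mul_transpose hS)

theorem inv_one_add_cayley {S : Matrix (Fin k) (Fin k) ℝ} (hS : IsUnit (1 + S).det) :
    (1 + cayley S)⁻¹ = (2⁻¹ : ℝ) • (1 + S) := by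
  refine Matrix.inv_eq_right_inv ?_
  rw [cayley, add_sub_cancel, smul_mul_smul_comm, Matrix.nonsing_inv_mul _ hS]
  norm_num

/-- The transform is an involution, so it serves as its own inverse when an orthogonal matrix near
`1` is given skew coordinates. -/
theorem cayley_cayley {S : Matrix (Fin k) (Fin k) ℝ} (hS : IsUnit (1 + S).det) :
    cayley (cayley S) = S := by
  rw [cayley, inv_one_add_cayley hS, smul_smul]
  norm_num

theorem cayley_zero : cayley (0 : Matrix (Fin k) (Fin k) ℝ) = 1 := by
  simp only [cayley, add_zero, inv_one, two_smul]
  abel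

theorem cayley_one : cayley (1 : Matrix (Fin k) (Fin k) ℝ) = 0 := by
  rw [← cayley_zero, cayley_cayley]
  simp

theorem cayley_transpose_of_orthogonal {Q : Matrix (Fin k) (Fin k) ℝ} (hQ : Q * Qᵀ = 1)
    (hu : IsUnit (1 + Q).det) : (cayley Q)ᵀ = -cayley Q := by
  have hT : (1 + Qᵀ)⁻¹ = Q * (1 + Q)⁻¹ := by
    refine Matrix.inv_eq_right_inv ?_
    rw [← mul_assoc, add_mul, one_mul, mul_eq_one_comm.1 hQ, add_comm, Matrix.mul_nonsing_inv _ hu]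
  have hs : (1 + Q)⁻¹ + Q * (1 + Q)⁻¹ = 1 := by
    have := Matrix.mul_nonsing_inv _ hu
    rwa [add_mul, one_mul] at this
  rw [cayley, Matrix.transpose_sub, Matrix.transpose_smul, Matrix.transpose_nonsing_inv,
    Matrix.transpose_add, Matrix.transpose_one, hT, eq_sub_of_add_eq' hs, smul_sub, two_smul ℝ 1]
  abel

theorem continuousAt_cayley {S : Matrix (Fin k) (Fin k) ℝ} (hS : IsUnit (1 + S).det) :
    ContinuousAt cayley S := by
  unfold cayley
  simp only [Matrix.inv_def, Ring.inverse_eq_inv']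
  have h : ContinuousAt (fun S : Matrix (Fin k) (Fin k) ℝ => (1 + S).det) S :=
    (Continuous.matrix_det (by fun_prop)).continuousAt
  have h2 : ContinuousAt (fun S : Matrix (Fin k) (Fin k) ℝ => (1 + S).adjugate) S :=
    (Continuous.matrix_adjugate (by fun_prop)).continuousAt
  exact (((h.inv₀ hS.ne_zero).smul h2).const_smul (2 : ℝ)).sub continuousAt_const

end Cayley

/-! ### The spectral chart, its derivative and its Jacobian. -/

section Chart

/-- Spectral coordinates: `v` is sent to the entries of `Q D Qᵀ`, where `D` has the diagonal
coordinates of `v` and `Q` is the Cayley transform of the skew-symmetric matrix with the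
off-diagonal coordinates of `v`. -/
def chart (k : ℕ) (v : UpperIdx k → ℝ) : UpperIdx k → ℝ :=
  upperEntries k (cayley (skewOfUpper k v) * Matrix.diagonal (diagCoords k v) *
    (cayley (skewOfUpper k v))ᵀ)

/-- Congruence by `Q` in the coordinates on and above the diagonal. -/
def congruence (Q : Matrix (Fin k) (Fin k) ℝ) : (UpperIdx k → ℝ) →ₗ[ℝ] (UpperIdx k → ℝ) :=
  upperEntries k ∘ₗ LinearMap.mulRight ℝ Qᵀ ∘ₗ LinearMap.mulLeft ℝ Q ∘ₗ symLin k

/-- Multiplication of the off-diagonal coordinates by the gaps of `d`. -/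
def gapScaling (d : Fin k → ℝ) : (UpperIdx k → ℝ) →ₗ[ℝ] (UpperIdx k → ℝ) :=
  Matrix.toLin' (Matrix.diagonal fun p : UpperIdx k =>
    if p.1.1 = p.1.2 then 1 else d p.1.2 - d p.1.1)

/-- The rotation velocity `Qᵀ dQ` of the Cayley transform `Q` of `S`, together with the unchanged
diagonal coordinates. -/
def rotationVelocity (S : Matrix (Fin k) (Fin k) ℝ) :
    (UpperIdx k → ℝ) →ₗ[ℝ] (UpperIdx k → ℝ) :=
  LinearMap.pi fun p => if p.1.1 = p.1.2 then LinearMap.proj p else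
    LinearMap.proj p ∘ₗ upperEntries k ∘ₗ LinearMap.mulLeft ℝ ((-2 : ℝ) • ((1 + S)⁻¹)ᵀ) ∘ₗ
      LinearMap.mulRight ℝ (1 + S)⁻¹ ∘ₗ skewOfUpper k

theorem congruence_apply (Q : Matrix (Fin k) (Fin k) ℝ) (w : UpperIdx k → ℝ) :
    congruence Q w = upperEntries k (Q * symOfUpper k w * Qᵀ) := rfl

theorem gapScaling_apply (d : Fin k → ℝ) (w : UpperIdx k → ℝ) (p : UpperIdx k) :
    gapScaling d w p = (if p.1.1 = p.1.2 then 1 else d p.1.2 - d p.1.1) * w p := by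
  simp [gapScaling, Matrix.toLin'_apply, Matrix.mulVec_diagonal]

theorem rotationVelocity_apply (S : Matrix (Fin k) (Fin k) ℝ) (w : UpperIdx k → ℝ)
    (p : UpperIdx k) : rotationVelocity S w p = if p.1.1 = p.1.2 then w p else
      ((-2 : ℝ) • ((1 + S)⁻¹)ᵀ * (skewOfUpper k w * (1 + S)⁻¹) :
        Matrix (Fin k) (Fin k) ℝ) p.1.1 p.1.2 := by
  simp only [rotationVelocity, LinearMap.pi_apply]
  split_ifs <;> rfl

/-- The derivative of `chart`. -/
def chartDeriv (v : UpperIdx k → ℝ) : (UpperIdx k → ℝ) →L[ℝ] (UpperIdx k → ℝ) :=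
  LinearMap.toContinuousLinearMap (congruence (cayley (skewOfUpper k v)) ∘ₗ
    gapScaling (diagCoords k v) ∘ₗ rotationVelocity (skewOfUpper k v))

/-- The commutator of a skew `Ω` with a diagonal matrix is symmetric with entries `Ω i j * (d j - d
i)`. This is where the eigenvalue gaps in the Jacobian come from. -/
theorem symOfUpper_gapScaling_rotationVelocity (S : Matrix (Fin k) (Fin k) ℝ)
    (d : Fin k → ℝ) (w : UpperIdx k → ℝ) (Ω : Matrix (Fin k) (Fin k) ℝ)
    (hΩ : Ω = (-2 : ℝ) • ((1 + S)⁻¹)ᵀ * (skewOfUpper k w * (1 + S)⁻¹)) :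
    symOfUpper k (gapScaling d (rotationVelocity S w)) =
      Ω * Matrix.diagonal d - Matrix.diagonal d * Ω + Matrix.diagonal (diagCoords k w) := by
  have hskew : Ωᵀ = -Ω := by
    rw [hΩ]
    simp only [Matrix.transpose_mul, Matrix.transpose_smul, Matrix.transpose_transpose,
      skewOfUpper_transpose, smul_mul_assoc, mul_assoc, neg_mul, mul_neg, smul_neg]
  refine ext_of_le_of_transpose (symOfUpper_transpose _) ?_ fun i j hij => ?_
  · simp only [Matrix.transpose_add, Matrix.transpose_sub, Matrix.transpose_mul,
      Matrix.diagonal_transpose, hskew]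
    noncomm_ring
  · rw [symOfUpper_apply_of_le _ hij, gapScaling_apply, rotationVelocity_apply, ← hΩ]
    simp only [Matrix.add_apply, Matrix.sub_apply, Matrix.mul_diagonal, Matrix.diagonal_mul]
    rcases hij.eq_or_lt with rfl | h
    · simp [diagCoords]
      ring
    · simp [h.ne]
      ring

theorem transpose_cayley_mul_inv {S : Matrix (Fin k) (Fin k) ℝ} (hS : Sᵀ = -S) :
    (cayley S)ᵀ * (1 + S)⁻¹ = ((1 + S)⁻¹)ᵀ := by
  have h := inv_one_add_add_transpose (S := -S) (by rw [Matrix.transpose_neg, hS])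
  have h2 : (1 + -S)⁻¹ = ((1 + S)⁻¹)ᵀ := by
    rw [Matrix.transpose_nonsing_inv, Matrix.transpose_add, Matrix.transpose_one, hS]
  rw [h2, Matrix.transpose_transpose] at h
  rw [cayley, Matrix.transpose_sub, Matrix.transpose_smul, Matrix.transpose_one, sub_mul,
    smul_mul_assoc, ← h, one_mul]
  abel

open scoped Matrix.Norms.Operator in
theorem hasFDerivAt_inv_one_add_skewOfUpper (v : UpperIdx k → ℝ) :
    HasFDerivAt (fun v => (1 + skewOfUpper k v)⁻¹)
      (-(ContinuousLinearMap.mulLeftRight ℝ (Matrix (Fin k) (Fin k) ℝ)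
        (1 + skewOfUpper k v)⁻¹ (1 + skewOfUpper k v)⁻¹ ∘L
        LinearMap.toContinuousLinearMap (skewOfUpper k))) v := by
  have hu := isUnit_det_one_add_of_skew (skewOfUpper_transpose v)
  obtain ⟨u, hu⟩ := (Matrix.isUnit_iff_isUnit_det _).2 hu
  have h1 : HasFDerivAt (fun v => 1 + skewOfUpper k v)
      (LinearMap.toContinuousLinearMap (skewOfUpper k)) v :=
    ((LinearMap.toContinuousLinearMap (skewOfUpper k)).hasFDerivAt).const_add 1
  have h2 := hasFDerivAt_ringInverse (𝕜 := ℝ) u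
  have h3 : (1 + skewOfUpper k v)⁻¹ = (↑u⁻¹ : Matrix (Fin k) (Fin k) ℝ) := by
    rw [← hu, Matrix.coe_units_inv]
  rw [h3]
  simp only [Matrix.nonsing_inv_eq_ringInverse]
  rw [hu] at h2
  exact h2.comp v h1

-- With `Ω = Qᵀ dQ` skew, differentiating `Q D Qᵀ` gives `Q (Ω D - D Ω + dD) Qᵀ`. This exhibits the
-- derivative as a composite of congruence, gap scaling and rotation velocity, so its determinant
-- factors.
open scoped Matrix.Norms.Operator in
theorem hasFDerivAt_chart (v : UpperIdx k → ℝ) : HasFDerivAt (chart k) (chartDeriv v) v := by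
  have hA := hasFDerivAt_inv_one_add_skewOfUpper v
  have hQ := (hA.const_smul (2 : ℝ)).sub_const (1 : Matrix (Fin k) (Fin k) ℝ)
  let T : Matrix (Fin k) (Fin k) ℝ →L[ℝ] Matrix (Fin k) (Fin k) ℝ :=
    LinearMap.toContinuousLinearMap (Matrix.transposeLinearEquiv (Fin k) (Fin k) ℝ ℝ).toLinearMap
  let Dg : (UpperIdx k → ℝ) →L[ℝ] Matrix (Fin k) (Fin k) ℝ :=
    LinearMap.toContinuousLinearMap (Matrix.diagonalLinearMap (Fin k) ℝ ℝ ∘ₗ diagCoords k)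
  have hQT := T.hasFDerivAt.comp v hQ
  have hmul := ((hQ.mul' Dg.hasFDerivAt).mul' hQT)
  have hfin := ((LinearMap.toContinuousLinearMap (upperEntries k)).hasFDerivAt).comp v hmul
  refine hfin.congr_fderiv ?_
  ext1 w
  set S := skewOfUpper k v with hS
  set A := (1 + S)⁻¹ with hAdef
  have hSk : Sᵀ = -S := skewOfUpper_transpose v
  have hQA : (cayley S)ᵀ * A = Aᵀ := transpose_cayley_mul_inv hSk
  have hQQ : cayley S * (cayley S)ᵀ = 1 := cayley_mul_transpose hSk
  have hR : chartDeriv v w = upperEntries k (cayley S *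
      symOfUpper k (gapScaling (diagCoords k v) (rotationVelocity S w)) * (cayley S)ᵀ) := rfl
  rw [hR, symOfUpper_gapScaling_rotationVelocity S (diagCoords k v) w _ rfl]
  set Q := cayley S with hQdef
  set D := Matrix.diagonal (diagCoords k v) with hD
  set W := skewOfUpper k w with hW
  set Ω := (-2 : ℝ) • Aᵀ * (W * A) with hΩ
  -- The left side is `dQ = -2 A W A`; `Q * Aᵀ = A` identifies it with `Q * Ω`.
  have hL : (2 : ℝ) • -(A * W * A) = Q * Ω := by
    have : Q * Aᵀ = A := by rw [← hQA, ← mul_assoc, hQQ, one_mul]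
    rw [hΩ, smul_mul_assoc, mul_smul_comm, ← mul_assoc, this]
    simp [mul_assoc]
  have hΩT : Ωᵀ = -Ω := by
    rw [hΩ]
    simp only [Matrix.transpose_mul, Matrix.transpose_smul, Matrix.transpose_transpose, hW,
      skewOfUpper_transpose, smul_mul_assoc, mul_assoc, neg_mul, mul_neg, smul_neg]
  change upperEntries k ((Q * D) * ((2 : ℝ) • -(A * W * A))ᵀ +
    (Q * Matrix.diagonal (diagCoords k w) + ((2 : ℝ) • -(A * W * A)) * D) * Qᵀ) = _
  rw [hL, Matrix.transpose_mul, hΩT]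
  congr 1
  noncomm_ring

theorem det_gapScaling (d : Fin k → ℝ) : LinearMap.det (gapScaling d) =
    ∏ i, ∏ j ∈ Finset.Ioi i, (d j - d i) := by
  rw [gapScaling, LinearMap.det_toLin', Matrix.det_diagonal]
  rw [Finset.prod_sigma', ← Finset.prod_filter_mul_prod_filter_not _
    (fun p : UpperIdx k => p.1.1 = p.1.2), Finset.prod_eq_one, one_mul]
  · refine Finset.prod_bij' (fun p _ => ⟨p.1.1, p.1.2⟩)
      (fun q hq => ⟨(q.1, q.2), (Finset.mem_Ioi.1 (Finset.mem_sigma.1 hq).2).le⟩)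
      ?_ ?_ ?_ ?_ ?_
    · intro p hp
      have := (Finset.mem_filter.1 hp).2
      simp [lt_of_le_of_ne p.2 this]
    · intro q hq
      have := (Finset.mem_Ioi.1 (Finset.mem_sigma.1 hq).2).ne
      simp [this]
    · intro p _
      rfl
    · intro q _
      rfl
    · intro p hp
      rw [if_neg (Finset.mem_filter.1 hp).2]
  · intro p hp
    rw [if_pos (Finset.mem_filter.1 hp).2]

theorem abs_det_gapScaling {d : Fin k → ℝ} (hd : StrictAnti d) : |LinearMap.det (gapScaling d)| =
    ∏ i, ∏ j ∈ Finset.Ioi i, (d i - d j) := by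
  rw [det_gapScaling, Finset.abs_prod]
  refine Finset.prod_congr rfl fun i _ => ?_
  rw [Finset.abs_prod]
  refine Finset.prod_congr rfl fun j hj => ?_
  rw [abs_sub_comm, abs_of_pos (sub_pos.2 (hd (Finset.mem_Ioi.1 hj)))]

/-- The angular factor of the Jacobian determinant of `chart`. -/
def angularJacobian (S : Matrix (Fin k) (Fin k) ℝ) : ℝ :=
  LinearMap.det (congruence (cayley S)) * LinearMap.det (rotationVelocity S)

theorem det_chartDeriv (v : UpperIdx k → ℝ) : (chartDeriv v).det =
    angularJacobian (skewOfUpper k v) * LinearMap.det (gapScaling (diagCoords k v)) := by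
  rw [chartDeriv, LinearMap.det_toContinuousLinearMap, LinearMap.det_comp, LinearMap.det_comp,
    angularJacobian]
  ring

theorem continuousAt_det_of_apply {X : Type*} [TopologicalSpace X] {x : X}
    {f : X → (UpperIdx k → ℝ) →ₗ[ℝ] (UpperIdx k → ℝ)}
    (hf : ∀ w, ContinuousAt (fun y => f y w) x) :
    ContinuousAt (fun y => LinearMap.det (f y)) x := by
  have h : ContinuousAt (fun y => LinearMap.toContinuousLinearMap (f y)) x :=
    continuousAt_clm_apply.2 hf
  have := ContinuousLinearMap.continuous_det.continuousAt.comp h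
  exact this

/-- At `S = 0` the congruence is the identity, and the rotation velocity is diagonal with entries
`1` and `-2`. -/
theorem angularJacobian_zero_ne_zero : angularJacobian (0 : Matrix (Fin k) (Fin k) ℝ) ≠ 0 := by
  have h1 : congruence (cayley (0 : Matrix (Fin k) (Fin k) ℝ)) = LinearMap.id := by
    refine LinearMap.ext fun w => ?_
    rw [congruence_apply, cayley_zero, Matrix.transpose_one, one_mul, mul_one,
      upperEntries_symOfUpper, LinearMap.id_apply]
  have h2 : rotationVelocity (0 : Matrix (Fin k) (Fin k) ℝ) =
      Matrix.toLin' (Matrix.diagonal fun p : UpperIdx k => if p.1.1 = p.1.2 then 1 else -2) := by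
    refine LinearMap.ext fun w => funext fun p => ?_
    rw [rotationVelocity_apply, Matrix.toLin'_apply, Matrix.mulVec_diagonal]
    split_ifs with h
    · simp
    · simp [skewOfUpper_apply_of_lt w (lt_of_le_of_ne p.2 h)]
  rw [angularJacobian, h1, h2, LinearMap.det_id, one_mul, LinearMap.det_toLin',
    Matrix.det_diagonal]
  refine Finset.prod_ne_zero_iff.2 fun p _ => ?_
  split_ifs <;> norm_num

theorem continuousAt_angularJacobian :
    ContinuousAt (angularJacobian (k := k)) 0 := by
  have hu : IsUnit (1 + (0 : Matrix (Fin k) (Fin k) ℝ)).det := by simp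
  have hc := continuousAt_cayley hu
  have hi : ContinuousAt (fun S : Matrix (Fin k) (Fin k) ℝ => (1 + S)⁻¹) 0 := by
    have : (fun S : Matrix (Fin k) (Fin k) ℝ => (1 + S)⁻¹) =
        fun S => (2⁻¹ : ℝ) • (cayley S + 1) := by
      ext1 S
      simp [cayley, smul_smul]
    rw [this]
    exact (hc.add continuousAt_const).const_smul (2⁻¹ : ℝ)
  refine (continuousAt_det_of_apply fun w => ?_).mul (continuousAt_det_of_apply fun w => ?_)
  · simp only [congruence_apply]
    have : Continuous fun M : Matrix (Fin k) (Fin k) ℝ => upperEntries k M :=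
      LinearMap.continuous_of_finiteDimensional _
    refine this.continuousAt.comp (ContinuousAt.mul (hc.mul continuousAt_const) ?_)
    exact (Continuous.matrix_transpose continuous_id).continuousAt.comp hc
  · refine continuousAt_pi.2 fun p => ?_
    simp only [rotationVelocity_apply]
    split_ifs
    · exact continuousAt_const
    · have hT : ContinuousAt (fun S : Matrix (Fin k) (Fin k) ℝ => ((1 + S)⁻¹)ᵀ) 0 :=
        (Continuous.matrix_transpose continuous_id).continuousAt.comp hi
      have := (hT.const_smul (-2 : ℝ)).mul
        (ContinuousAt.mul (continuousAt_const (y := skewOfUpper k w)) hi)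
      exact (continuous_apply_apply p.1.1 p.1.2).continuousAt.comp this

end Chart

/-! ### Injectivity of the chart and a finite cover of the orthogonal group. -/

section Cover

open scoped Topology

/-- The points whose off-diagonal coordinates are smaller than `r` in absolute value. -/
def angularBox (k : ℕ) (r : ℝ) : Set (UpperIdx k → ℝ) :=
  {v | ∀ p : UpperIdx k, p.1.1 ≠ p.1.2 → v p ∈ Set.Ioo (-r) r}

/-- The points whose diagonal coordinates are positive and strictly decreasing. -/
def spectralCone (k : ℕ) : Set (UpperIdx k → ℝ) :=
  {v | StrictAnti (diagCoords k v) ∧ ∀ i, 0 < diagCoords k v i}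

/-- The product of the gaps of `d`. -/
def gapProd (d : Fin k → ℝ) : ℝ := ∏ i, ∏ j ∈ Finset.Ioi i, (d i - d j)

theorem exists_entries_lt_of_mem_nhds {U : Set (Matrix (Fin k) (Fin k) ℝ)}
    (hU : U ∈ 𝓝 (0 : Matrix (Fin k) (Fin k) ℝ)) :
    ∃ r > 0, ∀ M : Matrix (Fin k) (Fin k) ℝ, (∀ i j, M i j ∈ Set.Ioo (-r) r) → M ∈ U := by
  obtain ⟨r, hr, h⟩ := Metric.mem_nhds_iff.1 (show U ∈ 𝓝 (0 : Fin k → Fin k → ℝ) from hU)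
  refine ⟨r, hr, fun M hM => h ?_⟩
  refine (dist_pi_lt_iff hr).2 fun i => (dist_pi_lt_iff hr).2 fun j => ?_
  rw [Real.dist_eq]
  simpa [abs_lt] using hM i j

theorem skewOfUpper_mem_Ioo {r : ℝ} (hr : 0 < r) {v : UpperIdx k → ℝ} (hv : v ∈ angularBox k r)
    (i j : Fin k) : skewOfUpper k v i j ∈ Set.Ioo (-r) r := by
  rcases lt_trichotomy i j with h | rfl | h
  · rw [skewOfUpper_apply_of_lt v h]
    exact hv ⟨(i, j), h.le⟩ h.ne
  · rw [skew_apply_self (skewOfUpper_transpose v)]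
    exact ⟨by linarith, hr⟩
  · have h2 := congrFun (congrFun (skewOfUpper_transpose v) i) j
    simp only [Matrix.transpose_apply, Matrix.neg_apply] at h2
    rw [skewOfUpper_apply_of_lt v h] at h2
    have := hv ⟨(j, i), h.le⟩ h.ne
    rw [h2] at this
    exact ⟨by linarith [this.2], by linarith [this.1]⟩

/-- Both properties are open conditions that hold at `S = 0`, where the Jacobian is nonzero and the
Cayley transform is `1`. The positivity of the diagonal of `Q'ᵀ Q` serves to rule out sign changes
and permutations of eigenvectors within one chart. -/
theorem exists_angular_radius (k : ℕ) : ∃ r > 0, ∃ c > 0, ∃ C > 0,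
    (∀ v ∈ angularBox k r, c ≤ |angularJacobian (skewOfUpper k v)| ∧
      |angularJacobian (skewOfUpper k v)| ≤ C) ∧
    ∀ v ∈ angularBox k r, ∀ w ∈ angularBox k r, ∀ i,
      0 < ((cayley (skewOfUpper k w))ᵀ * cayley (skewOfUpper k v)) i i := by
  have hJ : ContinuousAt (fun S : Matrix (Fin k) (Fin k) ℝ => |angularJacobian S|) 0 :=
    continuousAt_angularJacobian.abs
  have h0 : 0 < |angularJacobian (0 : Matrix (Fin k) (Fin k) ℝ)| :=
    abs_pos.2 angularJacobian_zero_ne_zero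
  set a := |angularJacobian (0 : Matrix (Fin k) (Fin k) ℝ)| with ha
  -- The factors `1 / 2` and `2` are arbitrary: any interval around `a` bounded away from `0` would
  -- do.
  have h1 : ∀ᶠ S in 𝓝 (0 : Matrix (Fin k) (Fin k) ℝ),
      |angularJacobian S| ∈ Set.Ioo (a / 2) (2 * a) :=
    hJ.eventually (Ioo_mem_nhds (by linarith) (by linarith))
  have h2 : ∀ᶠ p in 𝓝 ((0 : Matrix (Fin k) (Fin k) ℝ), (0 : Matrix (Fin k) (Fin k) ℝ)),
      ∀ i, 0 < ((cayley p.2)ᵀ * cayley p.1) i i := by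
    refine Filter.eventually_all.2 fun i => ?_
    have hu : IsUnit (1 + (0 : Matrix (Fin k) (Fin k) ℝ)).det := by simp
    have hc := continuousAt_cayley hu
    have hf : ContinuousAt (fun p : Matrix (Fin k) (Fin k) ℝ × Matrix (Fin k) (Fin k) ℝ =>
        (cayley p.2)ᵀ * cayley p.1) (0, 0) := by
      have hfst : ContinuousAt (fun p : Matrix (Fin k) (Fin k) ℝ × Matrix (Fin k) (Fin k) ℝ =>
        cayley p.1) (0, 0) := ContinuousAt.comp_of_eq hc continuousAt_fst rfl
      have hsnd : ContinuousAt (fun p : Matrix (Fin k) (Fin k) ℝ × Matrix (Fin k) (Fin k) ℝ =>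
        cayley p.2) (0, 0) := ContinuousAt.comp_of_eq hc continuousAt_snd rfl
      exact ((Continuous.matrix_transpose continuous_id).continuousAt.comp hsnd).mul hfst
    have hg := ContinuousAt.comp (g := fun M : Matrix (Fin k) (Fin k) ℝ => M i i)
      (continuous_apply_apply i i).continuousAt hf
    refine hg.eventually (lt_mem_nhds ?_)
    simp [cayley_zero]
  rw [nhds_prod_eq] at h2
  obtain ⟨t, ht, hts⟩ := Filter.mem_prod_self_iff.1 h2
  obtain ⟨r, hr, hrU⟩ := exists_entries_lt_of_mem_nhds (Filter.inter_mem h1 ht)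
  have hmem : ∀ v ∈ angularBox k r, skewOfUpper k v ∈ {S : Matrix (Fin k) (Fin k) ℝ |
      |angularJacobian S| ∈ Set.Ioo (a / 2) (2 * a)} ∩ t := fun v hv =>
    hrU _ (skewOfUpper_mem_Ioo hr hv)
  refine ⟨r, hr, a / 2, by linarith, 2 * a, by linarith, fun v hv => ?_, fun v hv w hw => ?_⟩
  · exact ⟨(hmem v hv).1.1.le, (hmem v hv).1.2.le⟩
  · intro i
    have h3 : (skewOfUpper k v, skewOfUpper k w) ∈ t ×ˢ t :=
      Set.mk_mem_prod (hmem v hv).2 (hmem w hw).2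
    have h4 := hts h3
    rw [Set.mem_ofPred_eq] at h4
    exact h4 i

theorem symOfUpper_chart (v : UpperIdx k → ℝ) : symOfUpper k (chart k v) =
    cayley (skewOfUpper k v) * Matrix.diagonal (diagCoords k v) * (cayley (skewOfUpper k v))ᵀ := by
  refine symOfUpper_upperEntries ?_
  simp [Matrix.transpose_mul, mul_assoc]

theorem symOfUpper_congruence (R : Matrix (Fin k) (Fin k) ℝ) (v : UpperIdx k → ℝ) :
    symOfUpper k (congruence R v) = R * symOfUpper k v * Rᵀ := by
  rw [congruence_apply]
  refine symOfUpper_upperEntries ?_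
  simp [Matrix.transpose_mul, symOfUpper_transpose, mul_assoc]

theorem congruence_mul (R R' : Matrix (Fin k) (Fin k) ℝ) :
    congruence (R * R') = congruence R ∘ₗ congruence R' := by
  refine LinearMap.ext fun v => ?_
  rw [LinearMap.comp_apply, congruence_apply, congruence_apply R, symOfUpper_congruence,
    Matrix.transpose_mul]
  simp only [mul_assoc]

theorem congruence_one : congruence (1 : Matrix (Fin k) (Fin k) ℝ) = LinearMap.id := by
  refine LinearMap.ext fun w => ?_
  rw [congruence_apply, Matrix.transpose_one, one_mul, mul_one,
    upperEntries_symOfUpper, LinearMap.id_apply]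

theorem congruence_transpose_comp {R : Matrix (Fin k) (Fin k) ℝ} (hR : R * Rᵀ = 1) :
    congruence Rᵀ ∘ₗ congruence R = LinearMap.id := by
  rw [← congruence_mul, mul_eq_one_comm.1 hR, congruence_one]

theorem congruence_injective {R : Matrix (Fin k) (Fin k) ℝ} (hR : R * Rᵀ = 1) :
    Function.Injective (congruence R) :=
  Function.LeftInverse.injective (g := congruence Rᵀ)
    fun v => LinearMap.congr_fun (congruence_transpose_comp hR) v

/-- Entrywise, `P i j * d j = d' i * P i j`. The positive diagonal of `P` gives `d = d'`, distinct
eigenvalues kill the off-diagonal entries, and an orthogonal diagonal matrix with positive entries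
is `1`. -/
theorem eq_of_orthogonal_diagonal_eq {P : Matrix (Fin k) (Fin k) ℝ} {d d' : Fin k → ℝ}
    (hP : P * Pᵀ = 1) (hpos : ∀ i, 0 < P i i) (hd : Function.Injective d)
    (h : P * Matrix.diagonal d = Matrix.diagonal d' * P) : d = d' ∧ P = 1 := by
  have hent : ∀ i j, P i j * d j = d' i * P i j := fun i j => by
    have := congrFun (congrFun h i) j
    rwa [Matrix.mul_diagonal, Matrix.diagonal_mul] at this
  have hdd : d = d' := funext fun i => by
    have := hent i i
    rw [mul_comm] at this
    exact mul_right_cancel₀ (hpos i).ne' this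
  subst hdd
  have hoff : ∀ i j, i ≠ j → P i j = 0 := fun i j hij => by
    have h1 := hent i j
    have h2 : d j - d i ≠ 0 := sub_ne_zero.2 fun h => hij (hd h).symm
    have h3 : P i j * (d j - d i) = 0 := by linarith
    exact (mul_eq_zero.1 h3).resolve_right h2
  refine ⟨rfl, ?_⟩
  ext i j
  by_cases hij : i = j
  · subst hij
    have h1 := congrFun (congrFun hP i) i
    rw [Matrix.mul_apply, Finset.sum_eq_single i (fun b _ hb => by rw [hoff i b hb.symm, zero_mul])
      (by simp)] at h1
    simp only [Matrix.transpose_apply, Matrix.one_apply_eq] at h1 ⊢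
    nlinarith [hpos i]
  · rw [hoff i j hij, Matrix.one_apply_ne hij]

theorem chart_injOn {r : ℝ} (hpos : ∀ v ∈ angularBox k r, ∀ w ∈ angularBox k r, ∀ i,
      0 < ((cayley (skewOfUpper k w))ᵀ * cayley (skewOfUpper k v)) i i) :
    Set.InjOn (chart k) (angularBox k r ∩ spectralCone k) := by
  intro v hv w hw h
  have hM := congrArg (symOfUpper k) h
  rw [symOfUpper_chart, symOfUpper_chart] at hM
  have hv1 := cayley_mul_transpose (skewOfUpper_transpose v)
  have hv2 := cayley_transpose_mul (skewOfUpper_transpose v)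
  have hw1 := cayley_mul_transpose (skewOfUpper_transpose w)
  have hw2 := cayley_transpose_mul (skewOfUpper_transpose w)
  have hp := hpos v hv.1 w hw.1
  have hC : ∀ u : UpperIdx k → ℝ, cayley (cayley (skewOfUpper k u)) = skewOfUpper k u :=
    fun u => cayley_cayley (isUnit_det_one_add_of_skew (skewOfUpper_transpose u))
  have hCv := hC v
  have hCw := hC w
  generalize cayley (skewOfUpper k v) = Q at *
  generalize cayley (skewOfUpper k w) = Q' at *
  -- Two spectral decompositions of the same matrix differ by `Q'ᵀ Q`, which intertwines the two
  -- diagonal matrices.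
  obtain ⟨hd, hP⟩ := eq_of_orthogonal_diagonal_eq (P := Q'ᵀ * Q) (d := diagCoords k v)
    (d' := diagCoords k w) (by
      rw [Matrix.transpose_mul, Matrix.transpose_transpose, mul_assoc, ← mul_assoc Q, hv1, one_mul,
        hw2]) hp hv.2.1.injective (by
      calc Q'ᵀ * Q * Matrix.diagonal (diagCoords k v)
          = Q'ᵀ * (Q * Matrix.diagonal (diagCoords k v) * Qᵀ) * Q := by
            simp only [mul_assoc, hv2, mul_one]
        _ = Q'ᵀ * Q' * Matrix.diagonal (diagCoords k w) * (Q'ᵀ * Q) := by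
            rw [hM]
            simp only [mul_assoc]
        _ = _ := by rw [hw2, one_mul])
  have hQ : Q = Q' := by
    rw [← one_mul Q, ← hw1, mul_assoc, hP, mul_one]
  have hS : skewOfUpper k v = skewOfUpper k w := by rw [← hCv, ← hCw, hQ]
  ext p
  rcases p.2.eq_or_lt with hp | hp
  · have := congrFun hd p.1.1
    have hpe : p = ⟨(p.1.1, p.1.1), le_rfl⟩ := Subtype.ext (Prod.ext rfl hp.symm)
    rw [hpe]
    exact this
  · have := congrFun (congrFun hS p.1.1) p.1.2
    rwa [skewOfUpper_apply_of_lt v hp, skewOfUpper_apply_of_lt w hp] at this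

theorem isCompact_orthogonal : IsCompact {Q : Matrix (Fin k) (Fin k) ℝ | Q * Qᵀ = 1} := by
  refine IsCompact.of_isClosed_subset (s := Set.univ.pi fun _ : Fin k => Set.univ.pi fun _ : Fin k =>
    Set.Icc (-1 : ℝ) 1) (isCompact_univ_pi fun _ => isCompact_univ_pi fun _ => isCompact_Icc) ?_ ?_
  · have hc : Continuous fun Q : Matrix (Fin k) (Fin k) ℝ => Q * Qᵀ :=
      continuous_id.mul (Continuous.matrix_transpose continuous_id)
    exact isClosed_singleton.preimage hc
  · intro (Q : Matrix (Fin k) (Fin k) ℝ) (hQ : Q * Qᵀ = 1) i _ j _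
    have h := congrFun (congrFun hQ i) i
    rw [Matrix.mul_apply, Matrix.one_apply_eq] at h
    have h2 : Q i j * Q i j ≤ 1 := by
      rw [← h]
      exact Finset.single_le_sum (f := fun j => Q i j * Qᵀ j i)
        (fun j _ => mul_self_nonneg (Q i j)) (Finset.mem_univ j)
    exact abs_le.1 (abs_le_one_iff_mul_self_le_one.2 h2)

/-- Every `R` in the compact orthogonal group has a neighbourhood of matrices `Q` with `Rᵀ Q` so
near `1` that its Cayley transform has entries below `r`. Centres `R` of either determinant are
allowed, so both components are reached. -/
theorem exists_finset_orthogonal_cover (k : ℕ) {r : ℝ} (hr : 0 < r) :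
    ∃ t : Finset (Matrix (Fin k) (Fin k) ℝ), (∀ R ∈ t, R * Rᵀ = 1) ∧
      ∀ Q : Matrix (Fin k) (Fin k) ℝ, Q * Qᵀ = 1 → ∀ d : Fin k → ℝ,
        ∃ R ∈ t, ∃ v ∈ angularBox k r, diagCoords k v = d ∧ Q = R * cayley (skewOfUpper k v) := by
  have hu1 : IsUnit (1 + (1 : Matrix (Fin k) (Fin k) ℝ)).det := by
    rw [← two_smul ℝ, Matrix.det_smul]
    simp
  let W : Set (Matrix (Fin k) (Fin k) ℝ) :=
    {Q | (1 + Q).det ≠ 0 ∧ ∀ i j, cayley Q i j ∈ Set.Ioo (-r) r}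
  have hW : W ∈ 𝓝 (1 : Matrix (Fin k) (Fin k) ℝ) := by
    refine Filter.inter_mem ?_ ?_
    · have : Continuous fun Q : Matrix (Fin k) (Fin k) ℝ => (1 + Q).det :=
        Continuous.matrix_det (by fun_prop)
      exact this.continuousAt.eventually_ne hu1.ne_zero
    · refine Filter.eventually_all.2 fun i => Filter.eventually_all.2 fun j => ?_
      have hg := ContinuousAt.comp (g := fun M : Matrix (Fin k) (Fin k) ℝ => M i j)
        (continuous_apply_apply i j).continuousAt (continuousAt_cayley hu1)
      refine hg.eventually (Ioo_mem_nhds ?_ ?_) <;> simp [cayley_one, hr]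
  obtain ⟨t, ht, htc⟩ := isCompact_orthogonal.elim_nhds_subcover
    (fun R : Matrix (Fin k) (Fin k) ℝ => (fun Q => Rᵀ * Q) ⁻¹' W) fun R hR => by
      have hc : Continuous fun Q : Matrix (Fin k) (Fin k) ℝ => Rᵀ * Q :=
        continuous_const.mul continuous_id
      refine hc.continuousAt.preimage_mem_nhds ?_
      rwa [mul_eq_one_comm.1 hR]
  refine ⟨t, ht, fun Q hQ d => ?_⟩
  obtain ⟨R, hRt, hRW⟩ := Set.mem_iUnion₂.1 (htc hQ)
  have hR : R * Rᵀ = 1 := ht R hRt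
  have hO : Rᵀ * Q * (Rᵀ * Q)ᵀ = 1 := by
    rw [Matrix.transpose_mul, Matrix.transpose_transpose, mul_assoc, ← mul_assoc Q, hQ, one_mul,
      mul_eq_one_comm.1 hR]
  have hu : IsUnit (1 + Rᵀ * Q).det := isUnit_iff_ne_zero.2 hRW.1
  have hsk := cayley_transpose_of_orthogonal hO hu
  -- Diagonal coordinates do not affect the skew part, so they are free to carry the prescribed `d`.
  let v : UpperIdx k → ℝ := fun p => if p.1.1 = p.1.2 then d p.1.1 else
    cayley (Rᵀ * Q) p.1.1 p.1.2
  have hv : skewOfUpper k v = cayley (Rᵀ * Q) :=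
    skewOfUpper_eq_of_forall_lt hsk fun i j hij => by simp [v, hij.ne]
  refine ⟨R, hRt, v, fun p hp => ?_, ?_, ?_⟩
  · simp only [v, if_neg hp]
    exact hRW.2 _ _
  · ext i
    simp [v, diagCoords]
  · rw [hv, cayley_cayley hu, ← mul_assoc, hR, one_mul]

end Cover

/-! ### Two-sided comparison of `dV` with spectral coordinates. -/

section PolarBounds

theorem measurable_diagCoords (k : ℕ) : Measurable (diagCoords k) :=
  measurable_pi_lambda _ fun _ => measurable_pi_apply _

theorem measurableSet_angularBox (k : ℕ) (r : ℝ) : MeasurableSet (angularBox k r) := by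
  have : angularBox k r = ⋂ p : UpperIdx k, ⋂ _ : p.1.1 ≠ p.1.2,
      (fun v => v p) ⁻¹' Set.Ioo (-r) r := by
    ext v
    simp [angularBox]
  rw [this]
  exact MeasurableSet.iInter fun p => MeasurableSet.iInter fun _ =>
    measurable_pi_apply p measurableSet_Ioo

theorem measurableSet_spectralCone (k : ℕ) : MeasurableSet (spectralCone k) := by
  have : spectralCone k = (⋂ i, ⋂ j, ⋂ _ : i < j, {v | diagCoords k v j < diagCoords k v i}) ∩
      ⋂ i, {v | 0 < diagCoords k v i} := by
    ext v
    simp [spectralCone, StrictAnti]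
  have hm : ∀ i, Measurable fun v => diagCoords k v i := fun i =>
    (measurable_pi_apply i).comp (measurable_diagCoords k)
  rw [this]
  exact (MeasurableSet.iInter fun i => MeasurableSet.iInter fun j => MeasurableSet.iInter fun _ =>
    measurableSet_lt (hm j) (hm i)).inter
      (MeasurableSet.iInter fun i => measurableSet_lt measurable_const (hm i))

theorem gapProd_nonneg {d : Fin k → ℝ} (hd : Antitone d) : 0 ≤ gapProd d :=
  Finset.prod_nonneg fun _ _ => Finset.prod_nonneg fun _ hj =>
    sub_nonneg.2 (hd (Finset.mem_Ioi.1 hj).le)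

theorem gapProd_pos {d : Fin k → ℝ} (hd : StrictAnti d) : 0 < gapProd d :=
  Finset.prod_pos fun _ _ => Finset.prod_pos fun _ hj =>
    sub_pos.2 (hd (Finset.mem_Ioi.1 hj))

theorem congruence_chart (R : Matrix (Fin k) (Fin k) ℝ) (v : UpperIdx k → ℝ) :
    congruence R (chart k v) = upperEntries k (R * cayley (skewOfUpper k v) *
      Matrix.diagonal (diagCoords k v) * (R * cayley (skewOfUpper k v))ᵀ) := by
  rw [congruence_apply, symOfUpper_chart, Matrix.transpose_mul]
  simp only [mul_assoc]

theorem orthogonal_mul_cayley {R : Matrix (Fin k) (Fin k) ℝ} (hR : R * Rᵀ = 1)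
    (v : UpperIdx k → ℝ) :
    R * cayley (skewOfUpper k v) * (R * cayley (skewOfUpper k v))ᵀ = 1 := by
  rw [Matrix.transpose_mul, mul_assoc, ← mul_assoc (cayley _),
    cayley_mul_transpose (skewOfUpper_transpose v), one_mul, hR]

theorem hasFDerivAt_congruence_chart (R : Matrix (Fin k) (Fin k) ℝ) (v : UpperIdx k → ℝ) :
    HasFDerivAt (fun v => congruence R (chart k v))
      (LinearMap.toContinuousLinearMap (congruence R) ∘L chartDeriv v) v :=
  (LinearMap.toContinuousLinearMap (congruence R)).hasFDerivAt.comp v (hasFDerivAt_chart v)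

theorem setLIntegral_image_congruence_chart {R : Matrix (Fin k) (Fin k) ℝ} (hR : R * Rᵀ = 1)
    {r : ℝ} (hpos : ∀ v ∈ angularBox k r, ∀ w ∈ angularBox k r, ∀ i,
      0 < ((cayley (skewOfUpper k w))ᵀ * cayley (skewOfUpper k v)) i i)
    (G : (UpperIdx k → ℝ) → ℝ≥0∞) :
    ∫⁻ u in (fun v => congruence R (chart k v)) '' (angularBox k r ∩ spectralCone k), G u =
      ∫⁻ v in angularBox k r ∩ spectralCone k,
        ENNReal.ofReal (|LinearMap.det (congruence R)| * |angularJacobian (skewOfUpper k v)| *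
          gapProd (diagCoords k v)) * G (congruence R (chart k v)) := by
  have hms := (measurableSet_angularBox k r).inter (measurableSet_spectralCone k)
  rw [lintegral_image_eq_lintegral_abs_det_fderiv_mul volume hms
    (fun v _ => (hasFDerivAt_congruence_chart R v).hasFDerivWithinAt)
    (fun v hv w hw h => chart_injOn hpos hv hw (congruence_injective hR h))]
  refine setLIntegral_congr_fun hms fun v hv => ?_
  have : (LinearMap.toContinuousLinearMap (congruence R) ∘L chartDeriv v).det =
      LinearMap.det (congruence R) * (chartDeriv v).det := by
    rw [← LinearMap.det_toContinuousLinearMap]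
    exact LinearMap.det_comp _ _
  simp only [this, det_chartDeriv, abs_mul, abs_det_gapScaling hv.2.1, gapProd, mul_assoc]

/-- This is a proper linear subspace. It makes the matrices with a repeated eigenvalue negligible.
-/
theorem volume_diagCoords_eq_zero {i j : Fin k} (hij : i ≠ j) :
    volume {v : UpperIdx k → ℝ | diagCoords k v i = diagCoords k v j} = 0 := by
  let f : (UpperIdx k → ℝ) →ₗ[ℝ] ℝ :=
    LinearMap.proj (R := ℝ) (φ := fun _ : UpperIdx k => ℝ) ⟨(i, i), le_rfl⟩ -
      LinearMap.proj (R := ℝ) (φ := fun _ : UpperIdx k => ℝ) ⟨(j, j), le_rfl⟩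
  have h : {v : UpperIdx k → ℝ | diagCoords k v i = diagCoords k v j} = LinearMap.ker f := by
    ext v
    simp [f, diagCoords, sub_eq_zero]
  rw [h]
  refine Measure.addHaar_submodule _ _ fun htop => ?_
  have h1 : (Pi.single (⟨(i, i), le_rfl⟩ : UpperIdx k) (1 : ℝ)) ∈ LinearMap.ker f := by
    rw [htop]; trivial
  have h2 : (⟨(j, j), le_rfl⟩ : UpperIdx k) ≠ ⟨(i, i), le_rfl⟩ := fun h => by
    simp at h
    exact hij h.symm
  simp [f, Pi.single_eq_of_ne h2] at h1

/-- A positive definite matrix is diagonalized by an orthogonal matrix, with eigenvalues in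
decreasing order. -/
theorem exists_orthogonal_diagonal {V : Matrix (Fin k) (Fin k) ℝ} (hV : V.PosDef) :
    ∃ (Q : Matrix (Fin k) (Fin k) ℝ) (d : Fin k → ℝ), Q * Qᵀ = 1 ∧ Antitone d ∧ (∀ i, 0 < d i) ∧
      V = Q * Matrix.diagonal d * Qᵀ := by
  have hs := hV.1.spectral_theorem
  rw [Unitary.conjStarAlgAut_apply] at hs
  set U : Matrix (Fin k) (Fin k) ℝ := (hV.1.eigenvectorUnitary : Matrix (Fin k) (Fin k) ℝ) with hU
  have hUU : U * Uᵀ = 1 := by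
    have := Unitary.mul_star_self_of_mem hV.1.eigenvectorUnitary.2
    rwa [Matrix.star_eq_conjTranspose, Matrix.conjTranspose_eq_transpose_of_trivial] at this
  set e := hV.1.eigenvalues with he
  -- Sorting `-e` increasingly puts the eigenvalues in decreasing order.
  let σ := Tuple.sort (fun i => -e i)
  refine ⟨U.submatrix id σ, e ∘ σ, ?_, ?_, fun i => hV.eigenvalues_pos _, ?_⟩
  · ext a b
    have := congrFun (congrFun hUU a) b
    rw [← this, Matrix.mul_apply, Matrix.mul_apply]
    exact Equiv.sum_comp σ fun i => U a i * Uᵀ i b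
  · intro i j hij
    have := Tuple.monotone_sort (fun i => -e i) hij
    simp only [Function.comp_apply, neg_le_neg_iff] at this
    exact this
  · conv_lhs => rw [hs]
    ext a b
    rw [Matrix.mul_apply, Matrix.mul_apply, ← Equiv.sum_comp σ]
    simp only [Matrix.mul_diagonal]
    rfl

theorem posDef_of_orthogonal_diagonal {Q : Matrix (Fin k) (Fin k) ℝ} (hQ : Q * Qᵀ = 1)
    {d : Fin k → ℝ} (hd : ∀ i, 0 < d i) : (Q * Matrix.diagonal d * Qᵀ).PosDef := by
  have h : (Matrix.diagonal d).PosDef := Matrix.PosDef.diagonal hd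
  have hu : IsUnit Q := ⟨⟨Q, Qᵀ, hQ, mul_eq_one_comm.1 hQ⟩, rfl⟩
  rw [← Matrix.conjTranspose_eq_transpose_of_trivial]
  refine h.mul_mul_conjTranspose_same ?_
  exact Matrix.vecMul_injective_of_isUnit hu

theorem symOfUpper_upperEntries_orthogonal_diagonal (Q : Matrix (Fin k) (Fin k) ℝ)
    (d : Fin k → ℝ) : symOfUpper k (upperEntries k (Q * Matrix.diagonal d * Qᵀ)) =
      Q * Matrix.diagonal d * Qᵀ :=
  symOfUpper_upperEntries (by simp [Matrix.transpose_mul, mul_assoc])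

/-- A substitute for integration in polar form, with constants that depend only on `k`. For the
upper bound, finitely many charts cover the positive definite matrices up to a null set; for the
lower bound, one injective chart suffices. -/
theorem exists_polar_bounds (k : ℕ) : ∃ r > 0, ∃ c C : ℝ≥0∞, c ≠ 0 ∧ C ≠ ∞ ∧
    ∀ (G : (UpperIdx k → ℝ) → ℝ≥0∞) (H : (Fin k → ℝ) → ℝ≥0∞),
      ((∀ (Q : Matrix (Fin k) (Fin k) ℝ) (d : Fin k → ℝ), Q * Qᵀ = 1 → StrictAnti d →
          (∀ i, 0 < d i) → G (upperEntries k (Q * Matrix.diagonal d * Qᵀ)) ≤ H d) →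
        ∫⁻ v in {v | (symOfUpper k v).PosDef}, G v ≤ C * ∫⁻ v in angularBox k r ∩ spectralCone k,
          ENNReal.ofReal (gapProd (diagCoords k v)) * H (diagCoords k v)) ∧
      ((∀ (Q : Matrix (Fin k) (Fin k) ℝ) (d : Fin k → ℝ), Q * Qᵀ = 1 → StrictAnti d →
          (∀ i, 0 < d i) → H d ≤ G (upperEntries k (Q * Matrix.diagonal d * Qᵀ))) →
        c * ∫⁻ v in angularBox k r ∩ spectralCone k,
          ENNReal.ofReal (gapProd (diagCoords k v)) * H (diagCoords k v) ≤
            ∫⁻ v in {v | (symOfUpper k v).PosDef}, G v) := by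
  obtain ⟨r, hr, c, hc, C, hC, hJ, hpos⟩ := exists_angular_radius k
  obtain ⟨t, ht, hcov⟩ := exists_finset_orthogonal_cover k hr
  have hms := (measurableSet_angularBox k r).inter (measurableSet_spectralCone k)
  -- The lower constant comes from the chart centred at `1`. The upper one sums over all centres,
  -- with the determinant of each congruence simply absorbed.
  refine ⟨r, hr, ENNReal.ofReal c, ∑ R ∈ t, ENNReal.ofReal (|LinearMap.det (congruence R)| * C),
    by simpa using hc, (ENNReal.sum_lt_top.2 fun _ _ => ENNReal.ofReal_lt_top).ne,
    fun G H => ⟨fun hGH => ?_, fun hGH => ?_⟩⟩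
  · let F : Matrix (Fin k) (Fin k) ℝ → (UpperIdx k → ℝ) → UpperIdx k → ℝ :=
      fun R v => congruence R (chart k v)
    let Z : Set (UpperIdx k → ℝ) :=
      ⋃ i, ⋃ j, ⋃ _ : i ≠ j, {v | diagCoords k v i = diagCoords k v j}
    have hZ : volume Z = 0 := by
      simp only [Z, measure_iUnion_null_iff]
      exact fun i j hij => volume_diagCoords_eq_zero hij
    -- A differentiable map between spaces of equal dimension sends null sets to null sets, so no
    -- injectivity is needed on `Z`.
    have hFZ : ∀ R, volume (F R '' Z) = 0 := fun R =>
      addHaar_image_eq_zero_of_differentiableOn_of_addHaar_eq_zero _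
        (fun v _ => (hasFDerivAt_congruence_chart R v).differentiableAt.differentiableWithinAt) hZ
    have hsub : {v | (symOfUpper k v).PosDef} ⊆
        ⋃ R ∈ t, (F R '' (angularBox k r ∩ spectralCone k) ∪ F R '' Z) := by
      intro u hu
      obtain ⟨Q, d, hQ, hd, hd0, hV⟩ := exists_orthogonal_diagonal hu
      obtain ⟨R, hRt, v, hv, hvd, hQv⟩ := hcov Q hQ d
      have hFv : F R v = u := by
        change congruence R (chart k v) = u
        rw [congruence_chart, ← hQv, hvd, ← hV, upperEntries_symOfUpper]
      refine Set.mem_iUnion₂.2 ⟨R, hRt, ?_⟩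
      by_cases hinj : Function.Injective d
      · refine Or.inl ⟨v, ⟨hv, ?_, ?_⟩, hFv⟩
        · rw [hvd]
          exact hd.strictAnti_of_injective hinj
        · rwa [hvd]
      · refine Or.inr ⟨v, ?_, hFv⟩
        obtain ⟨i, j, hij, hne⟩ := Function.not_injective_iff.1 hinj
        simp only [Z, Set.mem_iUnion]
        exact ⟨i, j, hne, by rw [← hvd] at hij; exact hij⟩
    calc ∫⁻ v in {v | (symOfUpper k v).PosDef}, G v
        ≤ ∫⁻ v in ⋃ R ∈ t, (F R '' (angularBox k r ∩ spectralCone k) ∪ F R '' Z), G v :=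
          lintegral_mono_set hsub
      _ ≤ ∑ R ∈ t, ∫⁻ v in F R '' (angularBox k r ∩ spectralCone k) ∪ F R '' Z, G v := by
          simp only [← Finset.mem_coe, Set.biUnion_eq_iUnion]
          refine (lintegral_iUnion_le _ _).trans ?_
          rw [tsum_fintype]
          exact (Finset.sum_coe_sort t fun R =>
            ∫⁻ v in F R '' (angularBox k r ∩ spectralCone k) ∪ F R '' Z, G v).le
      _ ≤ ∑ R ∈ t, ENNReal.ofReal (|LinearMap.det (congruence R)| * C) *
          ∫⁻ v in angularBox k r ∩ spectralCone k,
            ENNReal.ofReal (gapProd (diagCoords k v)) * H (diagCoords k v) := by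
          refine Finset.sum_le_sum fun R hR => ?_
          refine (lintegral_union_le _ _ _).trans ?_
          rw [setLIntegral_measure_zero _ _ (hFZ R), add_zero,
            setLIntegral_image_congruence_chart (ht R hR) hpos,
            ← lintegral_const_mul' _ _ ENNReal.ofReal_ne_top]
          refine setLIntegral_mono' hms fun v hv => ?_
          rw [← mul_assoc, ← ENNReal.ofReal_mul (by positivity)]
          refine mul_le_mul' (ENNReal.ofReal_le_ofReal ?_) ?_
          · have := gapProd_nonneg hv.2.1.antitone
            have h2 := (hJ v hv.1).2
            gcongr
          · rw [congruence_chart]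
            exact hGH _ _ (orthogonal_mul_cayley (ht R hR) v) hv.2.1 hv.2.2
      _ = _ := by rw [Finset.sum_mul]
  · have h1 : (1 : Matrix (Fin k) (Fin k) ℝ) * 1ᵀ = 1 := by simp
    calc _ ≤ ∫⁻ u in (fun v => congruence 1 (chart k v)) '' (angularBox k r ∩ spectralCone k),
          G u := by
          rw [setLIntegral_image_congruence_chart h1 hpos,
            ← lintegral_const_mul' _ _ ENNReal.ofReal_ne_top]
          refine setLIntegral_mono' hms fun v hv => ?_
          rw [← mul_assoc, ← ENNReal.ofReal_mul hc.le, congruence_one, LinearMap.det_id, abs_one,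
            one_mul]
          refine mul_le_mul' (ENNReal.ofReal_le_ofReal ?_) ?_
          · have := gapProd_nonneg hv.2.1.antitone
            have h2 := (hJ v hv.1).1
            gcongr
          · have h3 := congruence_chart 1 v
            rw [congruence_one] at h3
            rw [h3]
            exact hGH _ _ (orthogonal_mul_cayley h1 v) hv.2.1 hv.2.2
      _ ≤ _ := by
          refine lintegral_mono_set ?_
          rintro _ ⟨v, hv, rfl⟩
          simp only [Set.mem_ofPred_eq, congruence_chart]
          rw [symOfUpper_upperEntries_orthogonal_diagonal]
          exact posDef_of_orthogonal_diagonal (orthogonal_mul_cayley h1 v) hv.2.2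

end PolarBounds

/-! ### Convergence of the integral over the eigenvalues. -/

section SpectralIntegral

theorem prod_upperIdx_ite_eq {M : Type*} [CommMonoid M] (f : Fin k → M) :
    ∏ p : UpperIdx k, (if p.1.1 = p.1.2 then f p.1.1 else 1) = ∏ i, f i := by
  rw [← Finset.prod_filter]
  refine Finset.prod_bij' (fun p _ => p.1.1) (fun i _ => ⟨(i, i), le_rfl⟩) ?_ ?_ ?_ ?_ ?_
  · simp
  · simp
  · intro p hp
    exact Subtype.ext (Prod.ext rfl (Finset.mem_filter.1 hp).2)
  · simp
  · simp

/-- The box constrains only off-diagonal coordinates, each contributing its length `2 * r`; the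
diagonal coordinates run freely over the line. -/
theorem setLIntegral_angularBox_prod {r : ℝ} (g : Fin k → ℝ → ℝ≥0∞) (hg : ∀ i, Measurable (g i)) :
    ∫⁻ v in angularBox k r, ∏ i, g i (diagCoords k v i) =
      ∏ p : UpperIdx k, if p.1.1 = p.1.2 then ∫⁻ t, g p.1.1 t else ENNReal.ofReal (2 * r) := by
  classical
  let h : UpperIdx k → ℝ → ℝ≥0∞ := fun p =>
    if p.1.1 = p.1.2 then g p.1.1 else (Set.Ioo (-r) r).indicator 1
  have hh : ∀ p, Measurable (h p) := fun p => by
    simp only [h]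
    split_ifs
    · exact hg _
    · exact measurable_one.indicator measurableSet_Ioo
  have hprod : ∀ v, (angularBox k r).indicator (fun v => ∏ i, g i (diagCoords k v i)) v =
      ∏ p, h p (v p) := by
    intro v
    by_cases hv : v ∈ angularBox k r
    · rw [Set.indicator_of_mem hv, ← prod_upperIdx_ite_eq]
      refine Finset.prod_congr rfl fun p _ => ?_
      by_cases hp : p.1.1 = p.1.2
      · have hpe : p = ⟨(p.1.1, p.1.1), le_rfl⟩ := Subtype.ext (Prod.ext rfl hp.symm)
        simp only [h, if_pos hp]
        conv_rhs => rw [hpe]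
        rfl
      · simp only [h, if_neg hp]
        rw [Set.indicator_of_mem (hv p hp)]
        rfl
    · rw [Set.indicator_of_notMem hv]
      simp only [angularBox, Set.mem_ofPred_eq, not_forall] at hv
      obtain ⟨p, hp, hpv⟩ := hv
      refine (Finset.prod_eq_zero (Finset.mem_univ p) ?_).symm
      simp only [h, if_neg hp]
      exact Set.indicator_of_notMem hpv _
  rw [← lintegral_indicator (measurableSet_angularBox k r), lintegral_congr hprod,
    lintegral_fintype_prod_eq_prod h hh]
  refine Finset.prod_congr rfl fun p _ => ?_
  simp only [h]
  split_ifs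
  · rfl
  · rw [lintegral_indicator_one measurableSet_Ioo, Real.volume_Ioo]
    congr 1
    ring

/-- The density of the decreasing eigenvalues `d`. -/
def spectralWeight (l a e : ℝ) (d : Fin k → ℝ) : ℝ :=
  (∏ i, ((1 + d i) ^ (-e) * d i ^ (-a))) * gapProd d ^ l

/-- Each gap `d i - d j` is at most `1 + d i`, and at most `k - 1` indices `j` exceed `i`. -/
theorem gapProd_le {d : Fin k → ℝ} (hd : Antitone d) (h0 : ∀ i, 0 < d i) :
    gapProd d ≤ ∏ i, (1 + d i) ^ (k - 1) := by
  refine Finset.prod_le_prod (fun i _ => Finset.prod_nonneg fun j hj =>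
    sub_nonneg.2 (hd (Finset.mem_Ioi.1 hj).le)) fun i _ => ?_
  calc ∏ j ∈ Finset.Ioi i, (d i - d j) ≤ ∏ j ∈ Finset.Ioi i, (1 + d i) :=
        Finset.prod_le_prod (fun j hj => sub_nonneg.2 (hd (Finset.mem_Ioi.1 hj).le))
          fun j _ => by linarith [h0 j]
    _ ≤ (1 + d i) ^ (k - 1) := by
        rw [Finset.prod_const, Fin.card_Ioi]
        exact pow_le_pow_right₀ (by linarith [h0 i]) (by omega)

theorem spectralWeight_le {l a e : ℝ} (hl : 0 ≤ l) (hk : 1 ≤ k) {d : Fin k → ℝ}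
    (hd : Antitone d) (h0 : ∀ i, 0 < d i) :
    spectralWeight l a e d ≤ ∏ i, ((1 + d i) ^ (-(e - (k - 1) * l)) * d i ^ (-a)) := by
  have h1 : ∀ i, 0 < 1 + d i := fun i => by linarith [h0 i]
  have hg : gapProd d ^ l ≤ ∏ i, (1 + d i) ^ (((k : ℝ) - 1) * l) := by
    calc gapProd d ^ l ≤ (∏ i, (1 + d i) ^ (k - 1)) ^ l :=
          Real.rpow_le_rpow (gapProd_nonneg hd) (gapProd_le hd h0) hl
      _ = ∏ i, (1 + d i) ^ (((k : ℝ) - 1) * l) := by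
          rw [← Real.finsetProd_rpow _ _ fun i _ => pow_nonneg (h1 i).le _]
          refine Finset.prod_congr rfl fun i _ => ?_
          rw [← Real.rpow_natCast, ← Real.rpow_mul (h1 i).le, Nat.cast_sub hk, Nat.cast_one]
  calc spectralWeight l a e d ≤ (∏ i, ((1 + d i) ^ (-e) * d i ^ (-a))) *
        ∏ i, (1 + d i) ^ (((k : ℝ) - 1) * l) :=
        mul_le_mul_of_nonneg_left hg (Finset.prod_nonneg fun i _ =>
          mul_nonneg (Real.rpow_nonneg (h1 i).le _) (Real.rpow_nonneg (h0 i).le _))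
    _ = _ := by
        rw [← Finset.prod_mul_distrib]
        refine Finset.prod_congr rfl fun i _ => ?_
        rw [show -(e - ((k : ℝ) - 1) * l) = -e + (k - 1) * l by ring, Real.rpow_add (h1 i)]
        ring

/-- After `spectralWeight_le` the ordering of the eigenvalues can be dropped, and the integral
factors over the positive orthant. -/
theorem spectralIntegral_lt_top {r l a e : ℝ} (hl : 0 ≤ l) (hk : 1 ≤ k) (ha : a < 1)
    (hae : 1 < a + e - (k - 1) * l) :
    ∫⁻ v in angularBox k r ∩ spectralCone k,
      ENNReal.ofReal (spectralWeight l a e (diagCoords k v)) < ∞ := by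
  let φ : ℝ → ℝ := fun t => (1 + t) ^ (-(e - (k - 1) * l)) * t ^ (-a)
  let g : Fin k → ℝ → ℝ≥0∞ := fun _ => (Set.Ioi 0).indicator fun t => ENNReal.ofReal (φ t)
  have hg : ∀ i, Measurable (g i) := fun i =>
    Measurable.indicator (by fun_prop) measurableSet_Ioi
  have hms := (measurableSet_angularBox k r).inter (measurableSet_spectralCone k)
  calc _ ≤ ∫⁻ v in angularBox k r ∩ spectralCone k, ∏ i, g i (diagCoords k v i) := by
        refine setLIntegral_mono' hms fun v hv => ?_
        refine (ENNReal.ofReal_le_ofReal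
          (spectralWeight_le hl hk hv.2.1.antitone hv.2.2)).trans ?_
        rw [ENNReal.ofReal_prod_of_nonneg fun i _ => mul_nonneg
          (Real.rpow_nonneg (by linarith [hv.2.2 i]) _) (Real.rpow_nonneg (hv.2.2 i).le _)]
        refine le_of_eq (Finset.prod_congr rfl fun i _ => ?_)
        exact (Set.indicator_of_mem (s := Set.Ioi (0 : ℝ)) (hv.2.2 i)
          (fun t => ENNReal.ofReal (φ t))).symm
    _ ≤ ∫⁻ v in angularBox k r, ∏ i, g i (diagCoords k v i) :=
        lintegral_mono_set Set.inter_subset_left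
    _ < ∞ := by
        rw [setLIntegral_angularBox_prod g hg]
        refine ENNReal.prod_lt_top fun p _ => ?_
        split_ifs
        · simp only [g]
          rw [lintegral_indicator measurableSet_Ioi]
          exact lintegral_Ioi_rpow_mul_one_add_rpow_lt_top ha (by linarith)
        · exact ENNReal.ofReal_lt_top

/-- Disjoint unit intervals, ordered as decreasing eigenvalues. -/
def unitCell (k : ℕ) (i : Fin k) : Set ℝ :=
  Set.Ioo (2 * ((k : ℝ) - 1 - i) + 1) (2 * ((k : ℝ) - 1 - i) + 2)

/-- Only the eigenvalue `i₀` moves, over `T`; the others stay in their unit cells, each of length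
`1`. A lower bound in `d i₀` alone thus reduces divergence or positivity to a one-variable integral.
-/
theorem le_setLIntegral_spectral {r : ℝ} (w : (Fin k → ℝ) → ℝ) (i₀ : Fin k)
    {T : Set ℝ} (hT : MeasurableSet T) {φ : ℝ → ℝ} (hφ : Measurable φ) {c : ℝ} (hc : 0 < c)
    (h : ∀ d : Fin k → ℝ, d i₀ ∈ T → (∀ i ≠ i₀, d i ∈ unitCell k i) →
      StrictAnti d ∧ (∀ i, 0 < d i) ∧ c * φ (d i₀) ≤ w d) :
    ENNReal.ofReal c * ∏ p : UpperIdx k, (if p.1.1 = p.1.2 then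
      (if p.1.1 = i₀ then ∫⁻ t in T, ENNReal.ofReal (φ t) else 1) else ENNReal.ofReal (2 * r)) ≤
      ∫⁻ v in angularBox k r ∩ spectralCone k, ENNReal.ofReal (w (diagCoords k v)) := by
  classical
  let g : Fin k → ℝ → ℝ≥0∞ := fun i => if i = i₀ then T.indicator fun t => ENNReal.ofReal (φ t)
    else (unitCell k i).indicator 1
  have hg : ∀ i, Measurable (g i) := fun i => by
    simp only [g]
    split_ifs
    · exact Measurable.indicator (by fun_prop) hT
    · exact measurable_one.indicator measurableSet_Ioo
  have hint : ∀ i, ∫⁻ t, g i t = if i = i₀ then ∫⁻ t in T, ENNReal.ofReal (φ t) else 1 := by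
    intro i
    simp only [g]
    split_ifs
    · rw [lintegral_indicator hT]
    · rw [unitCell, lintegral_indicator_one measurableSet_Ioo, Real.volume_Ioo]
      norm_num
  simp only [← hint]
  rw [← setLIntegral_angularBox_prod g hg, ← lintegral_const_mul' _ _ ENNReal.ofReal_ne_top,
    ← lintegral_indicator (measurableSet_angularBox k r),
    ← lintegral_indicator ((measurableSet_angularBox k r).inter (measurableSet_spectralCone k))]
  refine lintegral_mono fun v => ?_
  by_cases hv : v ∈ angularBox k r
  swap
  · rw [Set.indicator_of_notMem hv]
    exact zero_le
  rw [Set.indicator_of_mem hv]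
  by_cases hd : diagCoords k v i₀ ∈ T ∧ ∀ i ≠ i₀, diagCoords k v i ∈ unitCell k i
  · obtain ⟨h1, h2, h3⟩ := h _ hd.1 hd.2
    have hmem : v ∈ angularBox k r ∩ spectralCone k := ⟨hv, h1, h2⟩
    rw [Set.indicator_of_mem hmem]
    refine le_trans (le_of_eq ?_) (ENNReal.ofReal_le_ofReal h3)
    rw [ENNReal.ofReal_mul hc.le, Finset.prod_eq_single i₀]
    · simp only [g, if_true]
      rw [Set.indicator_of_mem hd.1]
    · intro i _ hi
      simp only [g, if_neg hi]
      exact Set.indicator_of_mem (hd.2 i hi) _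
    · simp
  · have : ∏ i, g i (diagCoords k v i) = 0 := by
      by_cases h0 : diagCoords k v i₀ ∈ T
      · have : ∃ i ≠ i₀, diagCoords k v i ∉ unitCell k i := by
          by_contra! hcon
          exact hd ⟨h0, hcon⟩
        obtain ⟨i, hi, hiv⟩ := this
        refine Finset.prod_eq_zero (Finset.mem_univ i) ?_
        simp only [g, if_neg hi]
        exact Set.indicator_of_notMem hiv _
      · refine Finset.prod_eq_zero (Finset.mem_univ i₀) ?_
        simp only [g, if_true]
        exact Set.indicator_of_notMem h0 _
    simp only [this, mul_zero]
    exact zero_le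

theorem setLIntegral_spectral_ne_zero {r : ℝ} (hr : 0 < r) {w : (Fin k → ℝ) → ℝ} {i₀ : Fin k}
    {T : Set ℝ} (hT : MeasurableSet T) {φ : ℝ → ℝ} (hφ : Measurable φ) {c : ℝ} (hc : 0 < c)
    (h : ∀ d : Fin k → ℝ, d i₀ ∈ T → (∀ i ≠ i₀, d i ∈ unitCell k i) →
      StrictAnti d ∧ (∀ i, 0 < d i) ∧ c * φ (d i₀) ≤ w d)
    (hne : ∫⁻ t in T, ENNReal.ofReal (φ t) ≠ 0) :
    ∫⁻ v in angularBox k r ∩ spectralCone k, ENNReal.ofReal (w (diagCoords k v)) ≠ 0 := by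
  have hle := le_setLIntegral_spectral (r := r) w i₀ hT hφ hc h
  refine fun h0 => ?_
  rw [h0, nonpos_iff_eq_zero] at hle
  refine mul_ne_zero (ENNReal.ofReal_pos.2 hc).ne' (Finset.prod_ne_zero_iff.2 fun p _ => ?_) hle
  split_ifs
  · exact hne
  · exact one_ne_zero
  · exact (ENNReal.ofReal_pos.2 (by linarith)).ne'

theorem setLIntegral_spectral_eq_top {r : ℝ} (hr : 0 < r) {w : (Fin k → ℝ) → ℝ} {i₀ : Fin k}
    {T : Set ℝ} (hT : MeasurableSet T) {φ : ℝ → ℝ} (hφ : Measurable φ) {c : ℝ} (hc : 0 < c)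
    (h : ∀ d : Fin k → ℝ, d i₀ ∈ T → (∀ i ≠ i₀, d i ∈ unitCell k i) →
      StrictAnti d ∧ (∀ i, 0 < d i) ∧ c * φ (d i₀) ≤ w d)
    (htop : ∫⁻ t in T, ENNReal.ofReal (φ t) = ∞) :
    ∫⁻ v in angularBox k r ∩ spectralCone k, ENNReal.ofReal (w (diagCoords k v)) = ∞ := by
  have hle := le_setLIntegral_spectral (r := r) w i₀ hT hφ hc h
  rw [← top_le_iff]
  refine le_trans (le_of_eq ?_) hle
  -- The factor at the diagonal index `i₀` is infinite, and no other factor vanishes.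
  rw [← Finset.mul_prod_erase _ _ (Finset.mem_univ (⟨(i₀, i₀), le_rfl⟩ : UpperIdx k)), if_pos rfl,
    if_pos rfl, htop, ENNReal.top_mul, ENNReal.mul_top (ENNReal.ofReal_pos.2 hc).ne']
  refine Finset.prod_ne_zero_iff.2 fun p _ => ?_
  split_ifs
  · exact ENNReal.top_ne_zero
  · exact one_ne_zero
  · exact (ENNReal.ofReal_pos.2 (by linarith)).ne'

theorem rpow_neg_abs_le_rpow {B t : ℝ} (s : ℝ) (h1 : 1 ≤ t) (hB : t ≤ B) : B ^ (-|s|) ≤ t ^ s := by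
  have ht : 0 < t := by linarith
  calc B ^ (-|s|) ≤ t ^ (-|s|) :=
        Real.rpow_le_rpow_of_nonpos ht hB (neg_nonpos.2 (abs_nonneg s))
    _ ≤ t ^ s := Real.rpow_le_rpow_of_exponent_le h1 (neg_abs_le s)

theorem unitCell_bounds {i : Fin k} {t : ℝ} (ht : t ∈ unitCell k i) : 1 ≤ t ∧ t ≤ 2 * k := by
  have h1 : (i : ℝ) + 1 ≤ k := by exact_mod_cast i.2
  have h0 : (0 : ℝ) ≤ i := Nat.cast_nonneg _
  exact ⟨by linarith [ht.1], by linarith [ht.2]⟩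

theorem unitCell_gap {i j : Fin k} (hij : i < j) {s t : ℝ} (hs : s ∈ unitCell k i)
    (ht : t ∈ unitCell k j) : 1 ≤ s - t := by
  have h1 : (i : ℝ) + 1 ≤ j := by exact_mod_cast hij
  linarith [hs.1, ht.2]

/-- The `k - 1` other eigenvalues lie between `1` and `2 * k`, so their factors are bounded below
whatever the signs of `a` and `e`. -/
theorem mul_le_prod_of_mem_unitCell (a e : ℝ) {i₀ : Fin k} {d : Fin k → ℝ} (h0 : 0 < d i₀)
    (hd : ∀ i ≠ i₀, d i ∈ unitCell k i) :
    ((1 + d i₀) ^ (-e) * d i₀ ^ (-a)) *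
      ((1 + 2 * k : ℝ) ^ (-|e|) * (1 + 2 * k : ℝ) ^ (-|a|)) ^ (k - 1) ≤
      ∏ i, ((1 + d i) ^ (-e) * d i ^ (-a)) := by
  have hB : (0 : ℝ) < 1 + 2 * k := by positivity
  rw [← Finset.mul_prod_erase _ _ (Finset.mem_univ i₀)]
  refine mul_le_mul_of_nonneg_left ?_
    (mul_nonneg (Real.rpow_nonneg (by linarith) _) (Real.rpow_nonneg h0.le _))
  have hcard : (Finset.univ.erase i₀).card = k - 1 := by
    rw [Finset.card_erase_of_mem (Finset.mem_univ _), Finset.card_univ, Fintype.card_fin]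
  rw [← hcard, ← Finset.prod_const]
  refine Finset.prod_le_prod (fun i _ => by positivity) fun i hi => ?_
  obtain ⟨h1, h2⟩ := unitCell_bounds (hd i (Finset.ne_of_mem_erase hi))
  refine mul_le_mul ?_ ?_ (by positivity) (Real.rpow_nonneg (by linarith) _)
  · rw [← abs_neg]
    exact rpow_neg_abs_le_rpow _ (by linarith) (by linarith)
  · rw [← abs_neg]
    exact rpow_neg_abs_le_rpow _ h1 (by linarith)

/-- The smallest eigenvalue alone tends to zero. -/
theorem spectralIntegral_eq_top_of_one_le {r l a e : ℝ} (hr : 0 < r) (hl : 0 ≤ l) (hk : 1 ≤ k)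
    (ha : 1 ≤ a) :
    ∫⁻ v in angularBox k r ∩ spectralCone k,
      ENNReal.ofReal (spectralWeight l a e (diagCoords k v)) = ∞ := by
  let i₀ : Fin k := ⟨k - 1, by omega⟩
  have hlast : ∀ i ≠ i₀, i < i₀ := fun i hi =>
    lt_of_le_of_ne (Fin.le_def.2 (Nat.le_sub_one_of_lt i.2)) hi
  set b : ℝ := ((1 + 2 * k : ℝ) ^ (-|e|) * (1 + 2 * k : ℝ) ^ (-|a|)) ^ (k - 1) with hb
  have hb0 : 0 < b := by positivity
  refine setLIntegral_spectral_eq_top hr (i₀ := i₀) (T := Set.Ioo 0 1) measurableSet_Ioo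
    (φ := fun t => t ^ (-a)) (by fun_prop) (c := (1 + 2 * k : ℝ) ^ (-|e|) * b) (by positivity)
    (fun d hd0 hd => ?_) (lintegral_Ioo_rpow_eq_top (by linarith))
  have hgap : ∀ i j, i < j → 1 ≤ d i - d j := by
    intro i j hij
    have hi : i ≠ i₀ := fun h => by
      subst h
      exact absurd hij (not_lt_of_ge (Fin.le_def.2 (Nat.le_sub_one_of_lt j.2)))
    by_cases hj : j = i₀
    · subst hj
      have h1 := hd i hi
      have h2 : (i : ℝ) + 1 ≤ k - 1 := by
        have : (i : ℕ) < k - 1 := hlast i hi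
        have : (i : ℕ) + 2 ≤ k := by omega
        have : ((i : ℕ) : ℝ) + 2 ≤ k := by exact_mod_cast this
        linarith
      linarith [h1.1, hd0.2]
    · exact unitCell_gap hij (hd i hi) (hd j hj)
  have hpos : ∀ i, 0 < d i := fun i => by
    by_cases hi : i = i₀
    · rw [hi]; exact hd0.1
    · linarith [(unitCell_bounds (hd i hi)).1]
  -- All gaps are at least `1` here, so the gap factor can be discarded.
  have hgp : 1 ≤ gapProd d ^ l := by
    refine Real.one_le_rpow ?_ hl
    exact Finset.one_le_prod fun i _ => Finset.one_le_prod fun j hj =>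
      hgap i j (Finset.mem_Ioi.1 hj)
  refine ⟨fun i j hij => by linarith [hgap i j hij], hpos, ?_⟩
  have hmain := mul_le_prod_of_mem_unitCell a e hd0.1 hd
  have hB : (1 + 2 * k : ℝ) ^ (-|e|) ≤ (1 + d i₀) ^ (-e) := by
    rw [← abs_neg]
    refine rpow_neg_abs_le_rpow _ (by linarith [hd0.1]) ?_
    have : (1 : ℝ) ≤ k := by exact_mod_cast hk
    linarith [hd0.2]
  have hd0' : 0 ≤ d i₀ ^ (-a) := Real.rpow_nonneg hd0.1.le _
  calc (1 + 2 * k : ℝ) ^ (-|e|) * b * d i₀ ^ (-a)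
      = (1 + 2 * k : ℝ) ^ (-|e|) * d i₀ ^ (-a) * b := by ring
    _ ≤ (1 + d i₀) ^ (-e) * d i₀ ^ (-a) * b := by gcongr
    _ ≤ ∏ i, ((1 + d i) ^ (-e) * d i ^ (-a)) := hmain
    _ ≤ spectralWeight l a e d := by
        refine le_mul_of_one_le_right (Finset.prod_nonneg fun i _ => ?_) hgp
        exact mul_nonneg (Real.rpow_nonneg (by linarith [hpos i]) _)
          (Real.rpow_nonneg (hpos i).le _)

/-- The largest eigenvalue alone tends to infinity. -/
theorem spectralWeight_lower_bound_large {l a e : ℝ} (hl : 0 ≤ l) (hk : 1 ≤ k) :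
    ∃ c > 0, ∀ d : Fin k → ℝ, d ⟨0, hk⟩ ∈ Set.Ioi (4 * k : ℝ) →
      (∀ i ≠ ⟨0, hk⟩, d i ∈ unitCell k i) → StrictAnti d ∧ (∀ i, 0 < d i) ∧
        c * d ⟨0, hk⟩ ^ (-(a + e - (k - 1) * l)) ≤ spectralWeight l a e d := by
  set i₀ : Fin k := ⟨0, hk⟩ with hi₀
  set b : ℝ := ((1 + 2 * k : ℝ) ^ (-|e|) * (1 + 2 * k : ℝ) ^ (-|a|)) ^ (k - 1) with hb
  have hb0 : 0 < b := by positivity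
  have hk1 : (1 : ℝ) ≤ k := by exact_mod_cast hk
  -- The three factors come from replacing `1 + d i₀` by `d i₀`, from the eigenvalues in unit cells,
  -- and from bounding each gap of `d i₀` below by `d i₀ / 2`. The threshold `4 * k` is twice the
  -- bound `2 * k` on the other eigenvalues.
  refine ⟨(2 : ℝ) ^ (-|e|) * b * (2⁻¹ : ℝ) ^ (((k : ℝ) - 1) * l), by positivity,
    fun d hd0 hd => ?_⟩
  have hd0' : 4 * k < d i₀ := hd0
  have hdp : 0 < d i₀ := by linarith
  have hi0 : ∀ j, j ≠ i₀ → i₀ < j := fun j hj =>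
    lt_of_le_of_ne (Fin.le_def.2 (Nat.zero_le _)) hj.symm
  have hhalf : ∀ j, j ≠ i₀ → d i₀ * 2⁻¹ ≤ d i₀ - d j := fun j hj => by
    linarith [(unitCell_bounds (hd j hj)).2]
  have hgap : ∀ i j, i < j → 1 ≤ d i - d j := by
    intro i j hij
    have hj : j ≠ i₀ := fun h => by
      subst h
      exact absurd hij (not_lt_of_ge (Fin.le_def.2 (Nat.zero_le _)))
    by_cases hi : i = i₀
    · subst hi
      linarith [hhalf j hj]
    · exact unitCell_gap hij (hd i hi) (hd j hj)
  have hpos : ∀ i, 0 < d i := fun i => by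
    by_cases hi : i = i₀
    · rw [hi]; exact hdp
    · linarith [(unitCell_bounds (hd i hi)).1]
  have hgp : (d i₀ * 2⁻¹) ^ (k - 1) ≤ gapProd d := by
    rw [gapProd, ← Finset.mul_prod_erase _ _ (Finset.mem_univ i₀)]
    have h1 : (d i₀ * 2⁻¹) ^ (k - 1) ≤ ∏ j ∈ Finset.Ioi i₀, (d i₀ - d j) := by
      have hc : (Finset.Ioi i₀).card = k - 1 := by simp [hi₀]
      rw [← hc, ← Finset.prod_const]
      exact Finset.prod_le_prod (fun _ _ => by positivity) fun j hj =>
        hhalf j (Finset.mem_Ioi.1 hj).ne'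
    refine h1.trans (le_mul_of_one_le_right ((by positivity : (0 : ℝ) ≤ _).trans h1) ?_)
    exact Finset.one_le_prod fun i _ => Finset.one_le_prod fun j hj =>
      hgap i j (Finset.mem_Ioi.1 hj)
  have hgpl : d i₀ ^ (((k : ℝ) - 1) * l) * (2⁻¹ : ℝ) ^ (((k : ℝ) - 1) * l) ≤ gapProd d ^ l := by
    refine le_trans (le_of_eq ?_) (Real.rpow_le_rpow (by positivity) hgp hl)
    rw [← Real.rpow_natCast, ← Real.rpow_mul (by positivity), Nat.cast_sub hk, Nat.cast_one,
      Real.mul_rpow hdp.le (by norm_num)]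
  refine ⟨fun i j hij => by linarith [hgap i j hij], hpos, ?_⟩
  have hmain := mul_le_prod_of_mem_unitCell a e hdp hd
  have hB : (2 : ℝ) ^ (-|e|) * d i₀ ^ (-e) ≤ (1 + d i₀) ^ (-e) := by
    have h1 : 1 + d i₀ = (1 + (d i₀)⁻¹) * d i₀ := by field_simp; ring
    rw [h1, Real.mul_rpow (by positivity) hdp.le]
    refine mul_le_mul_of_nonneg_right ?_ (Real.rpow_nonneg hdp.le _)
    rw [← abs_neg]
    have : 0 < (d i₀)⁻¹ := by positivity
    have h2 : (d i₀)⁻¹ ≤ 1 := inv_le_one_of_one_le₀ (by linarith)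
    exact rpow_neg_abs_le_rpow _ (by linarith) (by linarith)
  have hexp : d i₀ ^ (-(a + e - (k - 1) * l)) =
      d i₀ ^ (-e) * d i₀ ^ (-a) * d i₀ ^ (((k : ℝ) - 1) * l) := by
    rw [← Real.rpow_add hdp, ← Real.rpow_add hdp]
    congr 1
    ring
  rw [hexp]
  calc _ = (2 : ℝ) ^ (-|e|) * d i₀ ^ (-e) * d i₀ ^ (-a) * b *
        (d i₀ ^ (((k : ℝ) - 1) * l) * (2⁻¹ : ℝ) ^ (((k : ℝ) - 1) * l)) := by ring
    _ ≤ (1 + d i₀) ^ (-e) * d i₀ ^ (-a) * b * gapProd d ^ l := by gcongr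
    _ ≤ spectralWeight l a e d :=
        mul_le_mul_of_nonneg_right hmain ((by positivity : (0 : ℝ) ≤ _).trans hgpl)

theorem spectralIntegral_eq_top_of_le_one {r l a e : ℝ} (hr : 0 < r) (hl : 0 ≤ l) (hk : 1 ≤ k)
    (hae : a + e - (k - 1) * l ≤ 1) :
    ∫⁻ v in angularBox k r ∩ spectralCone k,
      ENNReal.ofReal (spectralWeight l a e (diagCoords k v)) = ∞ := by
  obtain ⟨c, hc, h⟩ := spectralWeight_lower_bound_large (a := a) (e := e) hl hk
  have hk1 : (1 : ℝ) ≤ k := by exact_mod_cast hk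
  exact setLIntegral_spectral_eq_top hr measurableSet_Ioi
    (φ := fun t => t ^ (-(a + e - (k - 1) * l))) (by fun_prop) hc h
    (lintegral_Ioi_rpow_eq_top (by linarith) (by linarith))

theorem spectralIntegral_ne_zero {r l a e : ℝ} (hr : 0 < r) (hl : 0 ≤ l) (hk : 1 ≤ k) :
    ∫⁻ v in angularBox k r ∩ spectralCone k,
      ENNReal.ofReal (spectralWeight l a e (diagCoords k v)) ≠ 0 := by
  obtain ⟨c, hc, h⟩ := spectralWeight_lower_bound_large (a := a) (e := e) hl hk
  have hk1 : (1 : ℝ) ≤ k := by exact_mod_cast hk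
  refine setLIntegral_spectral_ne_zero hr measurableSet_Ioi
    (φ := fun t => t ^ (-(a + e - (k - 1) * l))) (by fun_prop) hc h ?_
  rw [← pos_iff_ne_zero, setLIntegral_pos_iff (by fun_prop)]
  have : Set.Ioi (4 * k : ℝ) ⊆ (Function.support fun t : ℝ =>
      ENNReal.ofReal (t ^ (-(a + e - (k - 1) * l)))) ∩ Set.Ioi (4 * k : ℝ) := fun t ht =>
    ⟨(ENNReal.ofReal_pos.2 (Real.rpow_pos_of_pos (by
      have : 4 * (k : ℝ) < t := ht
      linarith) _)).ne', ht⟩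
  refine lt_of_lt_of_le ?_ (measure_mono this)
  rw [Real.volume_Ioi]
  exact ENNReal.zero_lt_top

end SpectralIntegral

variable {m : ℕ}

/-! ### Integrating out `θ` and `β` for fixed `V`. -/

section Marginal

instance instBorelSpaceMatrix (k : ℕ) : BorelSpace (Matrix (Fin k) (Fin k) ℝ) :=
  inferInstanceAs (BorelSpace (Fin k → Fin k → ℝ))

theorem measurable_matrix_det (k : ℕ) :
    Measurable fun V : Matrix (Fin k) (Fin k) ℝ => V.det :=
  (Continuous.matrix_det continuous_id).measurable

theorem measurable_matrix_inv_apply (i j : Fin k) :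
    Measurable fun V : Matrix (Fin k) (Fin k) ℝ => V⁻¹ i j := by
  have h : Measurable fun V : Matrix (Fin k) (Fin k) ℝ => V.adjugate i j :=
    ((continuous_apply_apply i j).comp (Continuous.matrix_adjugate continuous_id)).measurable
  simp only [Matrix.inv_def, Ring.inverse_eq_inv', Matrix.smul_apply, smul_eq_mul]
  exact (measurable_matrix_det k).inv.mul h

theorem measurable_samplingDensity (x : Fin m → Fin k → ℝ) : Measurable (samplingDensity x) := by
  unfold samplingDensity dotProduct
  simp only [Pi.sub_apply]
  fun_prop

theorem measurable_stageDensity : Measurable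
    fun p : (Fin m → Fin k → ℝ) × (Fin k → ℝ) × Matrix (Fin k) (Fin k) ℝ =>
      stageDensity p.1 p.2.1 p.2.2 := by
  have h1 : Measurable fun p : (Fin m → Fin k → ℝ) × (Fin k → ℝ) × Matrix (Fin k) (Fin k) ℝ =>
      p.2.2.det := (measurable_matrix_det k).comp (measurable_snd.comp measurable_snd)
  have h2 : ∀ i j, Measurable
      fun p : (Fin m → Fin k → ℝ) × (Fin k → ℝ) × Matrix (Fin k) (Fin k) ℝ => p.2.2⁻¹ i j :=
    fun i j => (measurable_matrix_inv_apply i j).comp (measurable_snd.comp measurable_snd)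
  have h3 : ∀ i j, Measurable
      fun p : (Fin m → Fin k → ℝ) × (Fin k → ℝ) × Matrix (Fin k) (Fin k) ℝ =>
        p.1 i j - p.2.1 j := fun i j =>
    ((measurable_pi_apply j).comp ((measurable_pi_apply i).comp measurable_fst)).sub
      ((measurable_pi_apply j).comp (measurable_fst.comp measurable_snd))
  have h4 : ∀ i j, Measurable
      fun p : (Fin m → Fin k → ℝ) × (Fin k → ℝ) × Matrix (Fin k) (Fin k) ℝ =>
        (p.2.2⁻¹ *ᵥ (p.1 i - p.2.1)) j := fun i j => by
    simp only [Matrix.mulVec, dotProduct, Pi.sub_apply]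
    exact Finset.measurable_sum _ fun l _ => (h2 j l).mul (h3 i l)
  exact (measurable_const.div (measurable_const.mul (h1.pow_const _))).mul
    (Real.measurable_exp.comp (measurable_const.mul (Finset.measurable_sum _ fun i _ =>
      Finset.measurable_sum _ fun j _ => (h3 i j).mul (h4 i j))))

theorem measurable_jointDensity {πV : Matrix (Fin k) (Fin k) ℝ → ℝ≥0} (hπ : Measurable πV)
    (x : Fin m → Fin k → ℝ) : Measurable
    fun p : (Fin m → Fin k → ℝ) × (Fin k → ℝ) × Matrix (Fin k) (Fin k) ℝ =>
      jointDensity constPrior πV x p.1 p.2.1 p.2.2 := by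
  unfold jointDensity constPrior
  exact ((((measurable_samplingDensity x).comp measurable_fst).ennreal_ofReal.mul
    measurable_stageDensity.ennreal_ofReal).mul measurable_const).mul
      (hπ.comp (measurable_snd.comp measurable_snd)).coe_nnreal_ennreal

instance instSFiniteCovVolume (k : ℕ) : SFinite (covVolume k) := by
  unfold covVolume symVolume
  infer_instance

/-- The density of the data given `V`, with `θ` and `β` integrated out. -/
def covMarginal (x : Fin m → Fin k → ℝ) (V : Matrix (Fin k) (Fin k) ℝ) : ℝ≥0∞ :=
  ∫⁻ β : Fin k → ℝ, ∫⁻ θ : Fin m → Fin k → ℝ,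
    ENNReal.ofReal (samplingDensity x θ) * ENNReal.ofReal (stageDensity θ β V)

theorem measurable_covMarginal (x : Fin m → Fin k → ℝ) : Measurable (covMarginal x) := by
  unfold covMarginal
  have h : Measurable fun p : (Matrix (Fin k) (Fin k) ℝ × (Fin k → ℝ)) × (Fin m → Fin k → ℝ) =>
      ENNReal.ofReal (samplingDensity x p.2) * ENNReal.ofReal (stageDensity p.2 p.1.2 p.1.1) :=
    ((measurable_samplingDensity x).comp measurable_snd).ennreal_ofReal.mul
      (measurable_stageDensity.comp (measurable_snd.prodMk
        ((measurable_snd.comp measurable_fst).prodMk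
          (measurable_fst.comp measurable_fst)))).ennreal_ofReal
  exact (h.lintegral_prod_right').lintegral_prod_right'

theorem lintegral_lintegral_lintegral_reverse {A B C : Type*} [MeasurableSpace A]
    [MeasurableSpace B] [MeasurableSpace C] {μ : Measure A} {ν : Measure B} {ρ : Measure C}
    [SFinite μ] [SFinite ν] [SFinite ρ] {F : A × B × C → ℝ≥0∞} (hF : Measurable F) :
    ∫⁻ a, (∫⁻ b, (∫⁻ c, F (a, b, c) ∂ρ) ∂ν) ∂μ = ∫⁻ c, (∫⁻ b, (∫⁻ a, F (a, b, c) ∂μ) ∂ν) ∂ρ := by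
  have h1 : ∀ a, ∫⁻ b, (∫⁻ c, F (a, b, c) ∂ρ) ∂ν = ∫⁻ c, (∫⁻ b, F (a, b, c) ∂ν) ∂ρ := fun a =>
    lintegral_lintegral_swap (f := fun b c => F (a, b, c))
      (hF.comp (measurable_const.prodMk measurable_id)).aemeasurable
  have h2 : Measurable fun p : (A × C) × B => F (p.1.1, p.2, p.1.2) := by fun_prop
  have h3 : ∀ c, ∫⁻ a, (∫⁻ b, F (a, b, c) ∂ν) ∂μ = ∫⁻ b, (∫⁻ a, F (a, b, c) ∂μ) ∂ν := fun c =>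
    lintegral_lintegral_swap (f := fun a b => F (a, b, c))
      (hF.comp (measurable_fst.prodMk (measurable_snd.prodMk measurable_const))).aemeasurable
  simp only [h1, ← h3]
  exact lintegral_lintegral_swap (f := fun a c => ∫⁻ b, F (a, b, c) ∂ν)
    (h2.lintegral_prod_right').aemeasurable

theorem marginal_eq_lintegral_covMarginal {πV : Matrix (Fin k) (Fin k) ℝ → ℝ≥0}
    (hπ : Measurable πV) (x : Fin m → Fin k → ℝ) :
    marginal constPrior πV x = ∫⁻ V, covMarginal x V * πV V ∂(covVolume k) := by
  rw [marginal, lintegral_lintegral_lintegral_reverse (measurable_jointDensity hπ x)]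
  refine lintegral_congr fun V => ?_
  rw [covMarginal, ← lintegral_mul_const' _ _ ENNReal.coe_ne_top]
  refine lintegral_congr fun β => ?_
  rw [← lintegral_mul_const' _ _ ENNReal.coe_ne_top]
  simp [jointDensity, constPrior]

theorem lintegral_comp_orthogonal {Q : Matrix (Fin k) (Fin k) ℝ} (hQ : Q * Qᵀ = 1)
    {F : (Fin k → ℝ) → ℝ≥0∞} (hF : Measurable F) :
    ∫⁻ u : Fin k → ℝ, F (Q *ᵥ u) = ∫⁻ u : Fin k → ℝ, F u := by
  have hdet : Q.det * Q.det = 1 := by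
    have := congrArg Matrix.det hQ
    rwa [Matrix.det_mul, Matrix.det_transpose, Matrix.det_one] at this
  have habs : |(Q.det)⁻¹| = 1 := by
    rw [abs_inv, inv_eq_one]
    rcases mul_self_eq_one_iff.1 hdet with h | h <;> simp [h]
  have hmap := Real.map_matrix_volume_pi_eq_smul_volume_pi (left_ne_zero_of_mul_eq_one hdet)
  rw [habs, ENNReal.ofReal_one, one_smul] at hmap
  have hm : Measurable (Matrix.toLin' Q) :=
    (LinearMap.continuous_of_finiteDimensional _).measurable
  conv_rhs => rw [← hmap, lintegral_map hF hm]
  simp only [Matrix.toLin'_apply]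

theorem dotProduct_mulVec_self_of_orthogonal {Q : Matrix (Fin k) (Fin k) ℝ} (hQ : Q * Qᵀ = 1)
    (u : Fin k → ℝ) : u ⬝ᵥ u = ∑ j, (Qᵀ *ᵥ u) j ^ 2 := by
  have : u ⬝ᵥ u = (Qᵀ *ᵥ u) ⬝ᵥ (Qᵀ *ᵥ u) := by
    rw [Matrix.dotProduct_mulVec, Matrix.vecMul_transpose, Matrix.mulVec_mulVec, hQ,
      Matrix.one_mulVec]
  rw [this, dotProduct]
  exact Finset.sum_congr rfl fun j _ => (sq _).symm

theorem inv_orthogonal_diagonal {Q : Matrix (Fin k) (Fin k) ℝ} (hQ : Q * Qᵀ = 1)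
    {d : Fin k → ℝ} (hd : ∀ i, 0 < d i) : (Q * Matrix.diagonal d * Qᵀ)⁻¹ =
      Q * Matrix.diagonal (fun i => (d i)⁻¹) * Qᵀ := by
  refine Matrix.inv_eq_right_inv ?_
  have hQ' := mul_eq_one_comm.1 hQ
  calc Q * Matrix.diagonal d * Qᵀ * (Q * Matrix.diagonal (fun i => (d i)⁻¹) * Qᵀ)
      = Q * Matrix.diagonal d * (Qᵀ * Q) * Matrix.diagonal (fun i => (d i)⁻¹) * Qᵀ := by
        simp only [mul_assoc]
    _ = Q * (Matrix.diagonal d * Matrix.diagonal (fun i => (d i)⁻¹)) * Qᵀ := by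
        rw [hQ', mul_one, mul_assoc Q]
    _ = 1 := by
        rw [Matrix.diagonal_mul_diagonal]
        simp only [mul_inv_cancel₀ (hd _).ne', Matrix.diagonal_one, mul_one, hQ]

theorem det_orthogonal_conj {Q : Matrix (Fin k) (Fin k) ℝ} (hQ : Q * Qᵀ = 1)
    (M : Matrix (Fin k) (Fin k) ℝ) : (Q * M * Qᵀ).det = M.det := by
  have := congrArg Matrix.det hQ
  rw [Matrix.det_mul, Matrix.det_one] at this
  rw [Matrix.det_mul, Matrix.det_mul, mul_right_comm, this, one_mul]

theorem dotProduct_inv_orthogonal_diagonal {Q : Matrix (Fin k) (Fin k) ℝ} (hQ : Q * Qᵀ = 1)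
    {d : Fin k → ℝ} (hd : ∀ i, 0 < d i) (u : Fin k → ℝ) :
    u ⬝ᵥ ((Q * Matrix.diagonal d * Qᵀ)⁻¹ *ᵥ u) = ∑ j, (Qᵀ *ᵥ u) j ^ 2 / d j := by
  rw [inv_orthogonal_diagonal hQ hd, mul_assoc, ← Matrix.mulVec_mulVec, ← Matrix.mulVec_mulVec,
    Matrix.dotProduct_mulVec, ← Matrix.mulVec_transpose, dotProduct]
  refine Finset.sum_congr rfl fun j _ => ?_
  rw [Matrix.mulVec_diagonal]
  ring

/-- The normalizing constant of the joint density of `x` and `θ`. -/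
def normConst (m : ℕ) {k : ℕ} (d : Fin k → ℝ) : ℝ :=
  1 / (2 * Real.pi) ^ ((m * k : ℝ) / 2) *
    (1 / ((2 * Real.pi) ^ ((m * k : ℝ) / 2) * (∏ j, d j) ^ ((m : ℝ) / 2)))

theorem normConst_nonneg {d : Fin k → ℝ} (hd : ∀ i, 0 < d i) : 0 ≤ normConst m d := by
  have : 0 < ∏ j, d j := Finset.prod_pos fun j _ => hd j
  unfold normConst
  positivity

/-- In the eigenbasis of `V` both quadratic forms are diagonal, so the joint density becomes a
product over groups `i` and coordinates `j`. -/
theorem sampling_mul_stage_eq {Q : Matrix (Fin k) (Fin k) ℝ} (hQ : Q * Qᵀ = 1)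
    {d : Fin k → ℝ} (hd : ∀ i, 0 < d i) (x θ : Fin m → Fin k → ℝ) (β : Fin k → ℝ) :
    ENNReal.ofReal (samplingDensity x θ) *
      ENNReal.ofReal (stageDensity θ β (Q * Matrix.diagonal d * Qᵀ)) =
    ENNReal.ofReal (normConst m d) * ∏ i, ∏ j, ENNReal.ofReal (Real.exp (-(1 / 2) *
      (((Qᵀ *ᵥ x i) j - (Qᵀ *ᵥ θ i) j) ^ 2 + ((Qᵀ *ᵥ θ i) j - (Qᵀ *ᵥ β) j) ^ 2 / d j))) := by
  have hs : 0 ≤ samplingDensity x θ := by unfold samplingDensity; positivity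
  rw [← ENNReal.ofReal_mul hs]
  simp only [← ENNReal.ofReal_prod_of_nonneg fun _ _ => (Real.exp_pos _).le, ← Real.exp_sum]
  rw [← ENNReal.ofReal_mul (normConst_nonneg hd)]
  congr 1
  have h1 : ∀ i, ∑ j, -(1 / 2) * (((Qᵀ *ᵥ x i) j - (Qᵀ *ᵥ θ i) j) ^ 2 +
      ((Qᵀ *ᵥ θ i) j - (Qᵀ *ᵥ β) j) ^ 2 / d j) = -(1 / 2) * ((x i - θ i) ⬝ᵥ (x i - θ i)) +
      -(1 / 2) * ((θ i - β) ⬝ᵥ ((Q * Matrix.diagonal d * Qᵀ)⁻¹ *ᵥ (θ i - β))) := by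
    intro i
    rw [dotProduct_inv_orthogonal_diagonal hQ hd, dotProduct_mulVec_self_of_orthogonal hQ,
      ← mul_add, ← Finset.sum_add_distrib, Finset.mul_sum]
    simp only [Matrix.mulVec_sub, Pi.sub_apply]
  simp only [h1]
  rw [Finset.sum_add_distrib, ← Finset.mul_sum, ← Finset.mul_sum, Real.exp_add, samplingDensity,
    stageDensity, det_orthogonal_conj hQ, Matrix.det_diagonal, normConst]
  ring

theorem covMarginal_orthogonal_diagonal {Q : Matrix (Fin k) (Fin k) ℝ} (hQ : Q * Qᵀ = 1)
    {d : Fin k → ℝ} (hd : ∀ i, 0 < d i) (x : Fin m → Fin k → ℝ) :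
    covMarginal x (Q * Matrix.diagonal d * Qᵀ) =
      ENNReal.ofReal (normConst m d) *
        (∏ j, ENNReal.ofReal (√(2 * Real.pi * d j / (1 + d j)) ^ m)) *
        ∏ j, ∫⁻ b : ℝ, ENNReal.ofReal (Real.exp (-(1 / 2) *
          ((∑ i, ((Qᵀ *ᵥ x i) j - b) ^ 2) / (1 + d j)))) := by
  have hQT : Qᵀ * Qᵀᵀ = 1 := by rw [Matrix.transpose_transpose]; exact mul_eq_one_comm.1 hQ
  -- Rotating each `θ i` preserves Lebesgue measure, and each coordinate is then a one-dimensional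
  -- Gaussian convolution.
  have hθ : ∀ β : Fin k → ℝ, ∫⁻ θ : Fin m → Fin k → ℝ, ENNReal.ofReal (samplingDensity x θ) *
      ENNReal.ofReal (stageDensity θ β (Q * Matrix.diagonal d * Qᵀ)) =
      ENNReal.ofReal (normConst m d) *
        (∏ j, ENNReal.ofReal (√(2 * Real.pi * d j / (1 + d j)) ^ m)) *
        ∏ j, ENNReal.ofReal (Real.exp (-(1 / 2) *
          ((∑ i, ((Qᵀ *ᵥ x i) j - (Qᵀ *ᵥ β) j) ^ 2) / (1 + d j)))) := by
    intro β
    let f : Fin m → Fin k → ℝ → ℝ≥0∞ := fun i j t => ENNReal.ofReal (Real.exp (-(1 / 2) *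
      (((Qᵀ *ᵥ x i) j - t) ^ 2 + (t - (Qᵀ *ᵥ β) j) ^ 2 / d j)))
    have hf : ∀ i j, Measurable (f i j) := fun i j => by simp only [f]; fun_prop
    have hF : ∀ i, Measurable fun u : Fin k → ℝ => ∏ j, f i j (u j) := fun i =>
      Finset.measurable_prod _ fun j _ => (hf i j).comp (measurable_pi_apply j)
    have hmv : Measurable fun u : Fin k → ℝ => Qᵀ *ᵥ u :=
      (Matrix.mulVecLin Qᵀ).continuous_of_finiteDimensional.measurable
    simp only [sampling_mul_stage_eq hQ hd]
    rw [lintegral_const_mul' _ _ ENNReal.ofReal_ne_top, mul_assoc]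
    congr 1
    change ∫⁻ θ : Fin m → Fin k → ℝ, ∏ i, (fun u : Fin k → ℝ => ∏ j, f i j ((Qᵀ *ᵥ u) j)) (θ i) = _
    rw [lintegral_fintype_prod_eq_prod (fun i u => ∏ j, f i j ((Qᵀ *ᵥ u) j))
      fun i => (hF i).comp hmv]
    have hi : ∀ i, ∫⁻ u : Fin k → ℝ, ∏ j, f i j ((Qᵀ *ᵥ u) j) =
        ∏ j, ENNReal.ofReal (√(2 * Real.pi * d j / (1 + d j)) *
          Real.exp (-(1 / 2) * (((Qᵀ *ᵥ x i) j - (Qᵀ *ᵥ β) j) ^ 2 / (1 + d j)))) := by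
      intro i
      rw [lintegral_comp_orthogonal hQT (hF i), lintegral_fintype_prod_eq_prod _ (hf i)]
      exact Finset.prod_congr rfl fun j _ => lintegral_exp_convolution (hd j) _ _
    simp only [hi]
    rw [Finset.prod_comm, ← Finset.prod_mul_distrib]
    refine Finset.prod_congr rfl fun j _ => ?_
    rw [← ENNReal.ofReal_prod_of_nonneg fun _ _ => by positivity,
      ← ENNReal.ofReal_mul (by positivity), Finset.prod_mul_distrib, Finset.prod_const,
      Finset.card_univ, Fintype.card_fin, ← Real.exp_sum, Finset.sum_div, Finset.mul_sum]
  have hg : ∀ j, Measurable fun b : ℝ => ENNReal.ofReal (Real.exp (-(1 / 2) *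
      ((∑ i, ((Qᵀ *ᵥ x i) j - b) ^ 2) / (1 + d j)))) := fun j => by fun_prop
  rw [covMarginal]
  simp only [hθ]
  rw [lintegral_const_mul' _ _ (ENNReal.mul_ne_top ENNReal.ofReal_ne_top
    (ENNReal.prod_lt_top fun _ _ => ENNReal.ofReal_lt_top).ne)]
  congr 1
  rw [lintegral_comp_orthogonal hQT (F := fun u => ∏ j, ENNReal.ofReal (Real.exp (-(1 / 2) *
      ((∑ i, ((Qᵀ *ᵥ x i) j - u j) ^ 2) / (1 + d j)))))
    (Finset.measurable_prod _ fun j _ => (hg j).comp (measurable_pi_apply j))]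
  exact lintegral_fintype_prod_eq_prod _ hg

/-- The powers of `d` cancel, so the data leave no singularity at `d = 0`; `-m / 2 + 1 / 2` gives
the exponent of `1 + d`. -/
theorem rpow_mul_sqrt_pow_mul_sqrt (hm : 0 < m) {d : ℝ} (hd : 0 < d) :
    (d ^ ((m : ℝ) / 2))⁻¹ * √(2 * Real.pi * d / (1 + d)) ^ m * √(2 * Real.pi * (1 + d) / m) =
      (2 * Real.pi) ^ ((m : ℝ) / 2) * √(2 * Real.pi / m) * (1 + d) ^ (-(((m : ℝ) - 1) / 2)) := by
  have h1 : 0 < 1 + d := by linarith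
  have hm' : (0 : ℝ) < m := by exact_mod_cast hm
  have h2 : √(2 * Real.pi * d / (1 + d)) ^ m =
      (2 * Real.pi) ^ ((m : ℝ) / 2) * d ^ ((m : ℝ) / 2) * ((1 + d) ^ ((m : ℝ) / 2))⁻¹ := by
    rw [← Real.rpow_natCast, Real.sqrt_eq_rpow, ← Real.rpow_mul (by positivity),
      Real.div_rpow (by positivity) h1.le, Real.mul_rpow (by positivity) hd.le, div_eq_mul_inv,
      show (1 / 2 : ℝ) * m = m / 2 by ring]
  have h3 : √(2 * Real.pi * (1 + d) / m) = √(2 * Real.pi / m) * (1 + d) ^ (1 / 2 : ℝ) := by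
    rw [← Real.sqrt_eq_rpow, ← Real.sqrt_mul (by positivity)]
    congr 1
    ring
  have h4 : (1 + d) ^ (-(((m : ℝ) - 1) / 2)) =
      ((1 + d) ^ ((m : ℝ) / 2))⁻¹ * (1 + d) ^ (1 / 2 : ℝ) := by
    rw [← Real.rpow_neg h1.le, ← Real.rpow_add h1]
    congr 1
    ring
  have h5 : d ^ ((m : ℝ) / 2) ≠ 0 := (Real.rpow_pos_of_pos hd _).ne'
  rw [h2, h3, h4]
  field_simp

theorem exists_normConst_mul_eq (hm : 0 < m) (k : ℕ) : ∃ K : ℝ, 0 < K ∧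
    ∀ d : Fin k → ℝ, (∀ i, 0 < d i) →
      normConst m d * (∏ j, √(2 * Real.pi * d j / (1 + d j)) ^ m) *
        ∏ j, √(2 * Real.pi * (1 + d j) / m) = K * ∏ j, (1 + d j) ^ (-(((m : ℝ) - 1) / 2)) := by
  have hm' : (0 : ℝ) < m := by exact_mod_cast hm
  refine ⟨(1 / (2 * Real.pi) ^ ((m * k : ℝ) / 2)) * (1 / (2 * Real.pi) ^ ((m * k : ℝ) / 2)) *
    ∏ _j : Fin k, ((2 * Real.pi) ^ ((m : ℝ) / 2) * √(2 * Real.pi / m)), by positivity,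
    fun d hd => ?_⟩
  rw [mul_assoc, mul_assoc, mul_assoc, ← Finset.prod_mul_distrib, normConst,
    ← Real.finsetProd_rpow _ _ fun j _ => (hd j).le, ← Finset.prod_mul_distrib]
  simp only [← rpow_mul_sqrt_pow_mul_sqrt hm (hd _), Finset.prod_mul_distrib, Finset.prod_inv_distrib]
  field_simp

theorem exists_covMarginal_bounds (hm : 0 < m) (x : Fin m → Fin k → ℝ) : ∃ c C : ℝ, 0 < c ∧ 0 < C ∧
    ∀ (Q : Matrix (Fin k) (Fin k) ℝ) (d : Fin k → ℝ), Q * Qᵀ = 1 → (∀ i, 0 < d i) →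
      ENNReal.ofReal (c * ∏ j, (1 + d j) ^ (-(((m : ℝ) - 1) / 2))) ≤
        covMarginal x (Q * Matrix.diagonal d * Qᵀ) ∧
      covMarginal x (Q * Matrix.diagonal d * Qᵀ) ≤
        ENNReal.ofReal (C * ∏ j, (1 + d j) ^ (-(((m : ℝ) - 1) / 2))) := by
  obtain ⟨K, hK, hKd⟩ := exists_normConst_mul_eq hm k
  set s : ℝ := Real.exp (-(1 / 2) * ∑ i, x i ⬝ᵥ x i) with hs
  -- The lower constant carries the exponential `s` of the data: every `1 + d j` is at least `1` and
  -- rotation preserves norms, so `s` bounds the residual exponentials for all `Q` and `d` at once.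
  refine ⟨K * s, K, by positivity, hK, fun Q d hQ hd => ?_⟩
  have h1 : ∀ j, 0 < 1 + d j := fun j => by linarith [hd j]
  have hpre : ENNReal.ofReal (normConst m d) *
      (∏ j, ENNReal.ofReal (√(2 * Real.pi * d j / (1 + d j)) ^ m)) =
      ENNReal.ofReal (normConst m d * ∏ j, √(2 * Real.pi * d j / (1 + d j)) ^ m) := by
    rw [ENNReal.ofReal_mul (normConst_nonneg hd),
      ENNReal.ofReal_prod_of_nonneg fun _ _ => by positivity]
  have hnn : 0 ≤ normConst m d * ∏ j, √(2 * Real.pi * d j / (1 + d j)) ^ m :=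
    mul_nonneg (normConst_nonneg hd) (Finset.prod_nonneg fun _ _ => by positivity)
  rw [covMarginal_orthogonal_diagonal hQ hd, hpre]
  constructor
  · have hexp : s ≤ ∏ j, Real.exp (-(1 / 2) * ((∑ i, (Qᵀ *ᵥ x i) j ^ 2) / (1 + d j))) := by
      rw [hs, ← Real.exp_sum, ← Finset.mul_sum]
      refine Real.exp_le_exp.2 (mul_le_mul_of_nonpos_left ?_ (by norm_num))
      simp only [dotProduct_mulVec_self_of_orthogonal hQ]
      rw [Finset.sum_comm]
      refine Finset.sum_le_sum fun j _ => ?_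
      exact div_le_self (Finset.sum_nonneg fun _ _ => sq_nonneg _) (by linarith [hd j])
    calc ENNReal.ofReal (K * s * ∏ j, (1 + d j) ^ (-(((m : ℝ) - 1) / 2)))
        = ENNReal.ofReal (normConst m d * (∏ j, √(2 * Real.pi * d j / (1 + d j)) ^ m) *
          ((∏ j, √(2 * Real.pi * (1 + d j) / m)) * s)) := by
          rw [← mul_assoc, hKd d hd]
          congr 1
          ring
      _ ≤ ENNReal.ofReal (normConst m d * (∏ j, √(2 * Real.pi * d j / (1 + d j)) ^ m) *
          ∏ j, (√(2 * Real.pi * (1 + d j) / m) *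
            Real.exp (-(1 / 2) * ((∑ i, (Qᵀ *ᵥ x i) j ^ 2) / (1 + d j))))) := by
          rw [Finset.prod_mul_distrib]
          refine ENNReal.ofReal_le_ofReal (mul_le_mul_of_nonneg_left ?_ hnn)
          exact mul_le_mul_of_nonneg_left hexp (Finset.prod_nonneg fun _ _ => Real.sqrt_nonneg _)
      _ ≤ _ := by
          rw [ENNReal.ofReal_mul hnn, ENNReal.ofReal_prod_of_nonneg fun _ _ => by positivity]
          gcongr with j
          exact (lintegral_exp_sum_sq_le hm (h1 j) _).2
  · rw [← hKd d hd, ENNReal.ofReal_mul hnn,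
      ENNReal.ofReal_prod_of_nonneg fun _ _ => Real.sqrt_nonneg _]
    gcongr with j
    exact (lintegral_exp_sum_sq_le hm (h1 j) _).1

end Marginal

/-! ### Comparing the marginal with the eigenvalue integral. -/

section PosteriorExists

/-- The positive semidefinite matrices form a closed set, and positive definiteness adds only that
the determinant is nonzero. -/
theorem measurableSet_posDef (k : ℕ) :
    MeasurableSet {V : Matrix (Fin k) (Fin k) ℝ | V.PosDef} := by
  have h : {V : Matrix (Fin k) (Fin k) ℝ | V.PosDef} =
      ({V | Vᵀ = V} ∩ ⋂ x : Fin k → ℝ, {V | 0 ≤ x ⬝ᵥ (V *ᵥ x)}) ∩ {V | V.det ≠ 0} := by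
    ext V
    simp only [Set.mem_inter_iff, Set.mem_iInter, Set.mem_ofPred_eq]
    constructor
    · intro hV
      refine ⟨⟨?_, fun x => ?_⟩, hV.det_pos.ne'⟩
      · rw [← Matrix.conjTranspose_eq_transpose_of_trivial]
        exact hV.1
      · simpa using hV.posSemidef.dotProduct_mulVec_nonneg x
    · rintro ⟨⟨h1, h2⟩, h3⟩
      have hs : V.PosSemidef := Matrix.PosSemidef.of_dotProduct_mulVec_nonneg
        (by rw [Matrix.IsHermitian, Matrix.conjTranspose_eq_transpose_of_trivial, h1])
        fun x => by simpa using h2 x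
      exact hs.posDef_iff_det_ne_zero.2 h3
  rw [h]
  refine (IsClosed.inter ?_ (isClosed_iInter fun x => ?_)).measurableSet.inter ?_
  · exact isClosed_eq (Continuous.matrix_transpose continuous_id) continuous_id
  · exact isClosed_le continuous_const
      (Continuous.dotProduct continuous_const (Continuous.matrix_mulVec continuous_id
        continuous_const))
  · exact (measurableSet_eq_fun (measurable_matrix_det k) measurable_const).compl

theorem lintegral_covVolume {f : Matrix (Fin k) (Fin k) ℝ → ℝ≥0∞} (hf : Measurable f) :
    ∫⁻ V, f V ∂(covVolume k) =
      ∫⁻ v in {v | (symOfUpper k v).PosDef}, f (symOfUpper k v) := by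
  rw [covVolume, symVolume, Measure.restrict_map (measurable_symOfUpper k) (measurableSet_posDef k),
    lintegral_map hf (measurable_symOfUpper k)]
  rfl

theorem spectrum_orthogonal_diagonal {Q : Matrix (Fin k) (Fin k) ℝ} (hQ : Q * Qᵀ = 1)
    (d : Fin k → ℝ) : spectrum ℝ (Q * Matrix.diagonal d * Qᵀ) = Set.range d := by
  let u : (Matrix (Fin k) (Fin k) ℝ)ˣ := ⟨Q, Qᵀ, hQ, mul_eq_one_comm.1 hQ⟩
  have h := spectrum.units_conjugate (R := ℝ) (a := Matrix.diagonal d) (u := u)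
  rwa [spectrum_diagonal] at h

theorem det_one_add_orthogonal_diagonal {Q : Matrix (Fin k) (Fin k) ℝ} (hQ : Q * Qᵀ = 1)
    (d : Fin k → ℝ) : (1 + Q * Matrix.diagonal d * Qᵀ).det = ∏ i, (1 + d i) := by
  have : 1 + Q * Matrix.diagonal d * Qᵀ = Q * Matrix.diagonal (fun i => 1 + d i) * Qᵀ := by
    have h : Matrix.diagonal (fun i => 1 + d i) = 1 + Matrix.diagonal d := by
      rw [← Matrix.diagonal_one, Matrix.diagonal_add]
    rw [h, mul_add, add_mul, mul_one, hQ]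
  rw [this, det_orthogonal_conj hQ, Matrix.det_diagonal]

/-- Jacobian, Gaussian factor and prior combine: the gap powers `1` and `-(1 - l)` add to `l`, and
the powers of `1 + d i` add to `-(a₂ - a₁ + b)`. -/
theorem gapProd_mul_eq_spectralWeight (l a₁ a₂ b C : ℝ) {d : Fin k → ℝ} (hd : StrictAnti d)
    (h0 : ∀ i, 0 < d i) :
    gapProd d * ((∏ j, (1 + d j) ^ (-b)) * (C / ((∏ i, (1 + d i)) ^ (a₂ - a₁) *
      (∏ i, d i) ^ a₁ * gapProd d ^ (1 - l)))) =
      C * spectralWeight l a₁ (a₂ - a₁ + b) d := by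
  have h1 : ∀ i, 0 < 1 + d i := fun i => by linarith [h0 i]
  have hg := gapProd_pos hd
  have hgl : gapProd d ^ l = gapProd d * (gapProd d ^ (1 - l))⁻¹ := by
    rw [← Real.rpow_neg hg.le]
    nth_rewrite 2 [← Real.rpow_one (gapProd d)]
    rw [← Real.rpow_add hg]
    congr 1
    ring
  have h2 : ∏ i, ((1 + d i) ^ (-(a₂ - a₁ + b)) * d i ^ (-a₁)) =
      (∏ j, (1 + d j) ^ (-b)) * ((∏ i, (1 + d i)) ^ (a₂ - a₁))⁻¹ * ((∏ i, d i) ^ a₁)⁻¹ := by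
    rw [← Real.rpow_neg (Finset.prod_nonneg fun i _ => (h1 i).le),
      ← Real.rpow_neg (Finset.prod_nonneg fun i _ => (h0 i).le),
      ← Real.finsetProd_rpow _ _ fun i _ => (h1 i).le,
      ← Real.finsetProd_rpow _ _ fun i _ => (h0 i).le, ← Finset.prod_mul_distrib,
      ← Finset.prod_mul_distrib]
    refine Finset.prod_congr rfl fun i _ => ?_
    rw [← Real.rpow_add (h1 i)]
    congr 2
    ring
  rw [spectralWeight, h2, hgl, div_eq_mul_inv, mul_inv, mul_inv]
  ring

theorem exists_marginal_bounds (hm : 0 < m) {l a₁ a₂ : ℝ}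
    {πV : Matrix (Fin k) (Fin k) ℝ → ℝ≥0} (hmeas : Measurable πV)
    (hπV : Condition1 k l a₁ a₂ πV) (x : Fin m → Fin k → ℝ) :
    ∃ r > 0, ∃ c C : ℝ≥0∞, c ≠ 0 ∧ C ≠ ∞ ∧
      (c * ∫⁻ v in angularBox k r ∩ spectralCone k, ENNReal.ofReal
        (spectralWeight l a₁ (a₂ - a₁ + ((m : ℝ) - 1) / 2) (diagCoords k v))) ≤
        marginal constPrior πV x ∧
      marginal constPrior πV x ≤ C * ∫⁻ v in angularBox k r ∩ spectralCone k, ENNReal.ofReal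
        (spectralWeight l a₁ (a₂ - a₁ + ((m : ℝ) - 1) / 2) (diagCoords k v)) := by
  obtain ⟨C₁, C₂, hC₁, hC₂, hπ⟩ := hπV
  obtain ⟨c, C, hc, hC, hcov⟩ := exists_covMarginal_bounds hm x
  obtain ⟨r, hr, c', C', hc', hC', hpolar⟩ := exists_polar_bounds k
  have hms := (measurableSet_angularBox k r).inter (measurableSet_spectralCone k)
  let G : (UpperIdx k → ℝ) → ℝ≥0∞ := fun v =>
    covMarginal x (symOfUpper k v) * πV (symOfUpper k v)
  let H : ℝ → ℝ → (Fin k → ℝ) → ℝ≥0∞ := fun A B d =>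
    ENNReal.ofReal (A * ∏ j, (1 + d j) ^ (-(((m : ℝ) - 1) / 2))) *
      ENNReal.ofReal (B / ((∏ i, (1 + d i)) ^ (a₂ - a₁) * (∏ i, d i) ^ a₁ *
        gapProd d ^ (1 - l)))
  have hG : ∀ Q d, G (upperEntries k (Q * Matrix.diagonal d * Qᵀ)) =
      covMarginal x (Q * Matrix.diagonal d * Qᵀ) * πV (Q * Matrix.diagonal d * Qᵀ) := fun Q d => by
    simp only [G, symOfUpper_upperEntries_orthogonal_diagonal]
  have hcond : ∀ (Q : Matrix (Fin k) (Fin k) ℝ) (d : Fin k → ℝ), Q * Qᵀ = 1 → StrictAnti d →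
      (∀ i, 0 < d i) → _ := fun Q d hQ hd h0 =>
    hπ _ (posDef_of_orthogonal_diagonal hQ h0) d hd (spectrum_orthogonal_diagonal hQ d).symm
  have hH : ∀ {A B : ℝ}, 0 < A → 0 < B → ∫⁻ v in angularBox k r ∩ spectralCone k,
      ENNReal.ofReal (gapProd (diagCoords k v)) * H A B (diagCoords k v) =
      ENNReal.ofReal (A * B) * ∫⁻ v in angularBox k r ∩ spectralCone k, ENNReal.ofReal
        (spectralWeight l a₁ (a₂ - a₁ + ((m : ℝ) - 1) / 2) (diagCoords k v)) := by
    intro A B hA hB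
    rw [← lintegral_const_mul' _ _ ENNReal.ofReal_ne_top]
    refine setLIntegral_congr_fun hms fun v hv => ?_
    have h1 : 0 ≤ ∏ j, (1 + diagCoords k v j) ^ (-(((m : ℝ) - 1) / 2)) :=
      Finset.prod_nonneg fun j _ => Real.rpow_nonneg (by linarith [hv.2.2 j]) _
    have hg := gapProd_nonneg hv.2.1.antitone
    simp only [H]
    rw [← ENNReal.ofReal_mul (by positivity), ← ENNReal.ofReal_mul hg,
      ← ENNReal.ofReal_mul (by positivity)]
    congr 1
    rw [mul_assoc A, mul_left_comm, gapProd_mul_eq_spectralWeight l a₁ a₂ _ B hv.2.1 hv.2.2,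
      mul_assoc]
  have hmarg : marginal constPrior πV x = ∫⁻ v in {v | (symOfUpper k v).PosDef}, G v := by
    rw [marginal_eq_lintegral_covMarginal hmeas, lintegral_covVolume]
    exact (measurable_covMarginal x).mul hmeas.coe_nnreal_ennreal
  refine ⟨r, hr, c' * ENNReal.ofReal (c * C₁), C' * ENNReal.ofReal (C * C₂),
    mul_ne_zero hc' (ENNReal.ofReal_pos.2 (mul_pos hc hC₁)).ne',
    ENNReal.mul_ne_top hC' ENNReal.ofReal_ne_top, ?_, ?_⟩
  · rw [mul_assoc, ← hH hc hC₁, hmarg]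
    refine (hpolar G (H c C₁)).2 fun Q d hQ hd h0 => ?_
    have h := (hcond Q d hQ hd h0).1
    rw [det_one_add_orthogonal_diagonal hQ, det_orthogonal_conj hQ, Matrix.det_diagonal] at h
    rw [hG]
    refine mul_le_mul' (hcov Q d hQ h0).1 ?_
    rw [← ENNReal.ofReal_coe_nnreal]
    exact ENNReal.ofReal_le_ofReal h
  · rw [mul_assoc, ← hH hC hC₂, hmarg]
    refine (hpolar G (H C C₂)).1 fun Q d hQ hd h0 => ?_
    have h := (hcond Q d hQ hd h0).2
    rw [det_one_add_orthogonal_diagonal hQ, det_orthogonal_conj hQ, Matrix.det_diagonal] at h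
    rw [hG]
    refine mul_le_mul' (hcov Q d hQ h0).2 ?_
    rw [← ENNReal.ofReal_coe_nnreal]
    exact ENNReal.ofReal_le_ofReal h

theorem lintegral_prod_prod {A B C : Type*} [MeasurableSpace A]
    [MeasurableSpace B] [MeasurableSpace C] {μ : Measure A} {ν : Measure B} {ρ : Measure C}
    [SFinite ν] [SFinite ρ] {F : A × B × C → ℝ≥0∞} (hF : Measurable F) :
    ∫⁻ p, F p ∂(μ.prod (ν.prod ρ)) = ∫⁻ a, (∫⁻ b, (∫⁻ c, F (a, b, c) ∂ρ) ∂ν) ∂μ := by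
  rw [lintegral_prod _ hF.aemeasurable]
  refine lintegral_congr fun a => ?_
  exact lintegral_prod _ (hF.comp (measurable_const.prodMk measurable_id)).aemeasurable

theorem isProbabilityMeasure_posterior {πV : Matrix (Fin k) (Fin k) ℝ → ℝ≥0}
    (hmeas : Measurable πV) {x : Fin m → Fin k → ℝ} (h0 : marginal constPrior πV x ≠ 0)
    (htop : marginal constPrior πV x ≠ ∞) : IsProbabilityMeasure (posterior constPrior πV x) := by
  refine ⟨?_⟩
  rw [posterior, Measure.smul_apply, withDensity_apply _ MeasurableSet.univ, Measure.restrict_univ,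
    lintegral_prod_prod (measurable_jointDensity hmeas x), smul_eq_mul]
  exact ENNReal.inv_mul_cancel h0 htop

end PosteriorExists

end HierNormal

end

/-! ### The criterion for a proper posterior. -/

theorem theorem2p6 (m k : ℕ) (hm : 2 ≤ m) (hk : 2 ≤ k)
    (l a₁ a₂ : ℝ) (hl₀ : 0 ≤ l) (hl₁ : l ≤ 1)
    (πV : Matrix (Fin k) (Fin k) ℝ → ℝ≥0) (hmeas : Measurable πV)
    (hπV : HierNormal.Condition1 k l a₁ a₂ πV)
    (x : Fin m → Fin k → ℝ) :
    HierNormal.PosteriorExists HierNormal.constPrior πV x ↔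
      a₁ < 1 ∧ (3 - (m : ℝ)) / 2 + ((k : ℝ) - 1) * l < a₂ := by
  have hk1 : 1 ≤ k := by omega
  obtain ⟨r, hr, c, C, hc, hC, hlow, hup⟩ :=
    HierNormal.exists_marginal_bounds (by omega) hmeas hπV x
  have hne := HierNormal.spectralIntegral_ne_zero (a := a₁) (e := a₂ - a₁ + ((m : ℝ) - 1) / 2)
    hr hl₀ hk1
  constructor
  · rintro ⟨-, hlt, -⟩
    by_contra hcon
    have htop : ∫⁻ v in HierNormal.angularBox k r ∩ HierNormal.spectralCone k, ENNReal.ofReal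
        (HierNormal.spectralWeight l a₁ (a₂ - a₁ + ((m : ℝ) - 1) / 2)
          (HierNormal.diagCoords k v)) = ∞ := by
      rcases not_and_or.1 hcon with h | h
      · exact HierNormal.spectralIntegral_eq_top_of_one_le hr hl₀ hk1 (not_lt.1 h)
      -- Here `a₁ + e = a₂ + (m - 1) / 2`, so failure of the bound on `a₂` says exactly `a₁ + e - (k
      -- - 1) * l ≤ 1`.
      · refine HierNormal.spectralIntegral_eq_top_of_le_one hr hl₀ hk1 ?_
        linarith [not_lt.1 h]
    rw [htop, ENNReal.mul_top hc] at hlow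
    exact absurd (top_le_iff.1 hlow) hlt.ne
  · rintro ⟨h1, h2⟩
    have hfin := HierNormal.spectralIntegral_lt_top (r := r) (a := a₁)
      (e := a₂ - a₁ + ((m : ℝ) - 1) / 2) hl₀ hk1 h1 (by linarith)
    have hlt := hup.trans_lt (ENNReal.mul_lt_top hC.lt_top hfin)
    have hpos := (pos_iff_ne_zero.2 (mul_ne_zero hc hne)).trans_le hlow
    exact ⟨hpos, hlt, HierNormal.isProbabilityMeasure_posterior hmeas hpos.ne' hlt.ne⟩
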